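/- **Conventions.** Let $P$ be a finite graded poset with minimum $\hat 0$, maximum $\hat 1$ and rank function $\operatorname{rk}$, $\operatorname{rk}(\hat 0)=0$. For $s\le t$ let $\chi_{s,t}(x)=\sum_{s\le u\le t}\mu(s,u)\,x^{\operatorname{rk} t-\operatorname{rk} u}$ and, for $s<t$, $\overline\chi_{s,t}(x)=\chi_{s,t}(x)/(x-1)$. The Chow polynomial of $[s,t]$ is defined by $\underline{\mathrm H}_{s,s}=1$ and $\underline{\mathrm H}_{s,t}=\sum_{s<u\le t}\overline\chi_{s,u}\,\underline{\mathrm H}_{u,t}$ for $s<t$, and the augmented Chow polynomial by $\mathrm H_{s,t}=\sum_{s\le u\le t}x^{\operatorname{rk} u-\operatorname{rk} s}\,\underline{\mathrm H}_{u,t}$; write $\underline{\mathrm H}_{P}=\underline{\mathrm H}_{\hat 0,\hat 1}$, $\mathrm H_P=\mathrm H_{\hat 0,\hat 1}$, and similarly for $[a,\hat 1]$. If $f(x)=\sum_{i\le d/2}\gamma_i\,x^i(1+x)^{d-2i}$, put $\gamma(f;y)=\sum_i\gamma_i y^i$; here $d=n$ for the augmented Chow polynomial of an interval of rank $n$, and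 $d=\max(n-1,0)$ for its Chow polynomial. For real-rooted $f$ of degree $n$ with roots $\alpha_1\ge\dots\ge\alpha_n$ and $g$ of degree $n$ or $n+1$ with roots $\beta_1\ge\beta_2\ge\cdots$, write $f\preceq g$ if $(\beta_{n+1}\le)\,\alpha_n\le\beta_n\le\dots\le\alpha_1\le\beta_1$ (and by convention $0\preceq f$, $f\preceq 0$). The roots of $f$ and $g$ *interlace* if $f\preceq g$ or $g\preceq f$. An *EL-labeling* of $P$ is a map $\lambda$ from the covering pairs $s\lessdot t$ to a totally ordered set such that every interval has a unique maximal chain with weakly increasing labels, and this chain is lexicographically minimal among the maximal chains of the interval. For $s\in P$ let $\lambda_1<\dots<\lambda_\ell$ be the distinct labels of covers above $s$; put $\omega_s(i)=|\{t\gtrdot s:\lambda(s,t)=\lambda_i\}|$, $\mathrm{Ind}(s,t)=i$ if $\lambda(s,t)=\lambda_i$, and let $\mathrm{des}_s(t)$ be the number of distinct labels above $t$ that are smaller than $\lambda(s,t)$. The poset $P$ is *UMEL-shellable* if it has an EL-labeling such that, for $s,s'$ of the same rank $k$, $\omega_s=\omega_{s'}$, and $\mathrm{des}_s(t)=\mathrm{des}_{s'}(t')$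 whenever $\mathrm{Ind}(s,t)=\mathrm{Ind}(s',t')=i$ (call this number $\mathrm{des}_k(i)$), and such that each $\mathrm{des}_k(i)$ is weakly increasing in $i$. **Theorem.** Let $P$ be UMEL-shellable with such a labeling. The Chow and augmented Chow polynomials of all intervals $[s,\hat 1]$ have $\gamma$-expansions as above, and for every atom $a$ of $P$: 1. $\gamma(\underline{\mathrm H}_P;y)\preceq\gamma(\mathrm H_P;y)$, and the roots of $\underline{\mathrm H}_P(x)$ and $\mathrm H_P(x)$ interlace (this item does not involve $a$); 2. $\gamma(\mathrm H_{[a,\hat 1]};y)\preceq\gamma(\underline{\mathrm H}_P;y)$, and the roots of $\mathrm H_{[a,\hat 1]}(x)$ and $(1+x)\,\underline{\mathrm H}_P(x)$ interlace; 3. $\gamma(\mathrm H_{[a,\hat 1]};y)\preceq\gamma(\mathrm H_P;y)$, and the roots of $\mathrm H_{[a,\hat 1]}(x)$ and $\mathrm H_P(x)$ interlace; 4. if $\mathrm{des}_0(\ell)=\ell'$, where $\ell$ and $\ell'$ are the numbers of distinct labels above $\hat 0$ and above any atom, then $\gamma(\underline{\mathrm H}_{[a,\hat 1]};y)\preceq\gamma(\underline{\mathrm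 H}_P;y)$. The condition $\mathrm{des}_0(\ell)=\ell'$ holds whenever $P$ is atomic (every element is a join of atoms). -/

import Mathlib

open Polynomial

noncomputable section

/-! ### Chow polynomials of the intervals of a graded poset -/

section Chow

variable {P : Type*} [PartialOrder P] [LocallyFiniteOrder P] [DecidableEq P] [GradeMinOrder ℕ P]

/-- The rank of the interval `[s, t]`, for `s ≤ t`. -/
def intervalRank (s t : P) : ℕ := grade ℕ t - grade ℕ s

/-- The characteristic polynomial `∑_{s ≤ u ≤ t} μ(s, u) x ^ (rk t - rk u)` of `[s, t]`. -/
def charPoly (s t : P) : ℝ[X] :=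
  ∑ u ∈ Finset.Icc s t, C (IncidenceAlgebra.mu ℝ s u) * X ^ intervalRank u t

/-- The reduced characteristic polynomial of `[s, t]` for `s < t`: the characteristic polynomial,
which then vanishes at `1`, divided by `x - 1`. -/
def redCharPoly (s t : P) : ℝ[X] := charPoly s t /ₘ (X - C 1)

/-- The Chow polynomial of the interval `[s, t]`, for `s ≤ t`: it is `1` if `s = t`, and otherwise
the sum over `s < u ≤ t` of the reduced characteristic polynomial of `[s, u]` times the Chow
polynomial of `[u, t]`. -/
def chow (s t : P) : ℝ[X] :=
  if s = t then 1
  else ∑ u ∈ (Finset.Ioc s t).attach, redCharPoly s u.1 * chow u.1 t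
termination_by (Finset.Icc s t).card
decreasing_by
  have hu := Finset.mem_Ioc.mp u.2
  refine Finset.card_lt_card (Finset.ssubset_iff_of_subset ?_ |>.mpr ⟨s, ?_, ?_⟩)
  · exact Finset.Icc_subset_Icc_left hu.1.le
  · exact Finset.mem_Icc.mpr ⟨le_rfl, hu.1.le.trans hu.2⟩
  · exact fun h => absurd (Finset.mem_Icc.mp h).1 (not_le_of_gt hu.1)

/-- The augmented Chow polynomial of the interval `[s, t]`. -/
def augChow (s t : P) : ℝ[X] :=
  ∑ u ∈ Finset.Icc s t, X ^ intervalRank s u * chow u t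

end Chow

/-! ### Gamma-polynomials -/

/-- `g` is the `γ`-polynomial of `f` with respect to the center of symmetry `d / 2`. -/
def IsGammaPoly (d : ℕ) (f g : ℝ[X]) : Prop :=
  g.natDegree ≤ d / 2 ∧
    f = ∑ i ∈ Finset.range (d / 2 + 1), C (g.coeff i) * (X ^ i * (1 + X) ^ (d - 2 * i))

theorem gamma_basis_indep (m : ℕ) : ∀ (e : ℕ → ℕ) (c : ℕ → ℝ),
    ∑ i ∈ Finset.range m, C (c i) * (X ^ i * (1 + X : ℝ[X]) ^ e i) = 0 →
      ∀ i < m, c i = 0 := by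
  induction m with
  | zero => intro e c _ i hi; omega
  | succ m ih =>
    intro e c h
    rw [Finset.sum_range_succ'] at h
    have h0 : c 0 = 0 := by
      have := congrArg (Polynomial.eval 0) h
      simpa [Polynomial.eval_finsetSum] using this
    have h1 : X * ∑ i ∈ Finset.range m, C (c (i + 1)) * (X ^ i * (1 + X : ℝ[X]) ^ e (i + 1)) = 0 := by
      rw [Finset.mul_sum, ← h, h0]
      simp only [map_zero, zero_mul, add_zero]
      exact Finset.sum_congr rfl fun i _ => by ring
    have h2 := (mul_eq_zero.mp h1).resolve_left X_ne_zero
    intro i hi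
    rcases i with _ | i
    · exact h0
    · exact ih (fun i => e (i + 1)) (fun i => c (i + 1)) h2 i (by omega)

/-- The `γ`-polynomial is unique. -/
theorem IsGammaPoly.unique {d : ℕ} {f g h : ℝ[X]} (hg : IsGammaPoly d f g)
    (hh : IsGammaPoly d f h) : g = h := by
  have key := gamma_basis_indep (d / 2 + 1) (fun i => d - 2 * i) (fun i => g.coeff i - h.coeff i) (by
    simp only [map_sub, sub_mul, Finset.sum_sub_distrib]
    rw [← hg.2, ← hh.2, sub_self])
  ext i
  by_cases hi : i < d / 2 + 1
  · exact sub_eq_zero.mp (key i hi)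
  · rw [coeff_eq_zero_of_natDegree_lt (lt_of_le_of_lt hg.1 (by omega)),
      coeff_eq_zero_of_natDegree_lt (lt_of_le_of_lt hh.1 (by omega))]

open Classical in
/-- The `γ`-polynomial of `f` with respect to the center of symmetry `d / 2`; it is meaningful when
`f` is symmetric with that center, that is, when `IsGammaPoly d f g` holds for some `g`. -/
def gammaPoly (d : ℕ) (f : ℝ[X]) : ℝ[X] :=
  if h : ∃ g, IsGammaPoly d f g then h.choose else 0

theorem IsGammaPoly.gammaPoly_eq {d : ℕ} {f g : ℝ[X]} (hg : IsGammaPoly d f g) :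
    gammaPoly d f = g := by
  have h : ∃ g, IsGammaPoly d f g := ⟨g, hg⟩
  rw [gammaPoly, dif_pos h]
  exact h.choose_spec.unique hg

section Gamma

variable {P : Type*} [PartialOrder P] [LocallyFiniteOrder P] [DecidableEq P] [GradeMinOrder ℕ P]

/-- The `γ`-polynomial of the Chow polynomial of `[s, t]`. If `[s, t]` has rank `n ≥ 1` the center
of symmetry is `(n - 1) / 2`; if `s = t` it is `0`. -/
def gammaChow (s t : P) : ℝ[X] := gammaPoly (intervalRank s t - 1) (chow s t)

/-- The `γ`-polynomial of the augmented Chow polynomial of `[s, t]`, whose center of symmetry is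
half the rank of `[s, t]`. -/
def gammaAugChow (s t : P) : ℝ[X] := gammaPoly (intervalRank s t) (augChow s t)

end Gamma

/-! ### Interlacing polynomials -/

/-- `f ⪯ g`. Both polynomials are real-rooted. If they are nonzero, `f` has degree `n` and `g` has
degree `m ∈ {n, n + 1}`, with roots `α 0 ≥ α 1 ≥ ⋯` and `β 0 ≥ β 1 ≥ ⋯` (with multiplicity) such
that `⋯ ≤ β 1 ≤ α 0 ≤ β 0`. By convention `0 ⪯ f` and `f ⪯ 0` for all real-rooted `f`. -/
def Interlaces (f g : ℝ[X]) : Prop :=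
  (f = 0 ∧ g.Splits) ∨ (g = 0 ∧ f.Splits) ∨
    ∃ (n m : ℕ) (a b : ℝ) (α β : ℕ → ℝ),
      a ≠ 0 ∧ b ≠ 0 ∧ (m = n ∨ m = n + 1) ∧
      f = C a * ∏ i ∈ Finset.range n, (X - C (α i)) ∧
      g = C b * ∏ i ∈ Finset.range m, (X - C (β i)) ∧
      (∀ i < n, α i ≤ β i) ∧ (∀ i, i + 1 < m → β (i + 1) ≤ α i)

/-- The zeros of `f` and `g` interlace. -/
def ZerosInterlace (f g : ℝ[X]) : Prop := Interlaces f g ∨ Interlaces g f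

/-! ### Edge labelings

An edge labeling is a function `lam : P → P → Λ` into a totally ordered set, of which only the values
`lam s t` on covering pairs `s ⋖ t` are used. -/

section Labelings

variable {P Λ : Type*} [PartialOrder P] [LinearOrder Λ]

/-- `c` lists the elements of a saturated chain `s = u₀ ⋖ u₁ ⋖ ⋯ ⋖ uₖ = t`, i.e. of a maximal chain
of the interval `[s, t]`. -/
def IsSaturatedChain (s t : P) (c : List P) : Prop :=
  c.IsChain (· ⋖ ·) ∧ c.head? = some s ∧ c.getLast? = some t

/-- The list of labels along a saturated chain. -/
def labelSeq (lam : P → P → Λ) (c : List P) : List Λ := List.zipWith lam c c.tail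

/-- `lam` is edge-lexicographical: each interval has a unique maximal chain with weakly increasing
labels, and this chain is lexicographically minimal among all maximal chains of the interval. -/
def IsELLabeling (lam : P → P → Λ) : Prop :=
  ∀ s t : P, s ≤ t → ∃ c : List P,
    IsSaturatedChain s t c ∧ (labelSeq lam c).Pairwise (· ≤ ·) ∧
    (∀ c', IsSaturatedChain s t c' → (labelSeq lam c').Pairwise (· ≤ ·) → c' = c) ∧
    ∀ c', IsSaturatedChain s t c' → ¬ List.Lex (· < ·) (labelSeq lam c') (labelSeq lam c)

/-- The set of labels of the covering relations above `s`. -/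
def labelsAbove (lam : P → P → Λ) (s : P) : Set Λ := {x | ∃ t, s ⋖ t ∧ lam s t = x}

/-- The index of the label of `s ⋖ t`: it is `i` if this is the `i`-th smallest of the labels above
`s` (counting from `1`). -/
def labelIndex (lam : P → P → Λ) (s t : P) : ℕ := {x ∈ labelsAbove lam s | x ≤ lam s t}.ncard

/-- The width above `s` at `i`: the number of covers of `s` labeled by the `i`-th label above `s`. -/
def labelWidth (lam : P → P → Λ) (s : P) (i : ℕ) : ℕ :=
  {t | s ⋖ t ∧ labelIndex lam s t = i}.ncard

/-- The descent count of `s ⋖ t`: the number of labels above `t` smaller than the label of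
`s ⋖ t`. -/
def labelDes (lam : P → P → Λ) (s t : P) : ℕ := {x ∈ labelsAbove lam t | x < lam s t}.ncard

variable [GradeMinOrder ℕ P]

/-- `lam` makes `P` a monotonic rank-uniform (EL-)labeled poset. A finite graded bounded poset is
UMEL-shellable if it admits such a labeling. -/
structure IsUMELLabeling (lam : P → P → Λ) : Prop where
  el : IsELLabeling lam
  uniform_width : ∀ s s' : P, grade ℕ s = grade ℕ s' →
    ∀ i, 1 ≤ i → labelWidth lam s i = labelWidth lam s' i
  uniform_descent : ∀ s s' t t' : P, grade ℕ s = grade ℕ s' → s ⋖ t → s' ⋖ t' →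
    labelIndex lam s t = labelIndex lam s' t' → labelDes lam s t = labelDes lam s' t'
  monotonic : ∀ s s' t t' : P, grade ℕ s = grade ℕ s' → s ⋖ t → s' ⋖ t' →
    labelIndex lam s t ≤ labelIndex lam s' t' → labelDes lam s t ≤ labelDes lam s' t'

/-- The condition `des₀(ℓ) = ℓ'`, with `ℓ` the number of labels above `⊥` and `ℓ'` the number of
labels above any atom `a`: the value `des₀(ℓ)` is the descent count of `⊥ ⋖ b` for any atom `b`
whose label is the `ℓ`-th (the largest) label above `⊥`. -/
def LastLabelAllDescents [OrderBot P] (lam : P → P → Λ) : Prop :=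
  ∀ a b : P, IsAtom a → IsAtom b → labelIndex lam ⊥ b = (labelsAbove lam (⊥ : P)).ncard →
    labelDes lam ⊥ b = (labelsAbove lam a).ncard

end Labelings

end

-- For `s < u` an EL-labeling singles out one cover `s ⋖ t`, the first step of the rising chain from
-- `s` to `u`. Möbius inversion turns the definition of the Chow polynomial into a positive sum over
-- `u > s` (`chow_eq_one_add_sum`). Grouping its terms by `t` splits the Chow and augmented Chow
-- polynomials of `[s, ⊤]` into contributions `edgeChow lam s t` and `edgeAugChow lam s t`.
-- Shortening rising chains by their first step gives recursions (`edgeChow_eq_sum_edgeAugChow`,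
-- `edgeAugChow_eq`) that separate the covers of `t` into descents and non-descents and multiply
-- only by `1 + x` and `x`. On γ-polynomials these act as the identity and as multiplication by `y`.
-- Under a UMEL-labeling the outcome depends only on corank and label index, so the γ-polynomials
-- are the numerically defined families `G = noFirstDescentPoly` and `F = isolatedDescentPoly`
-- (`isGammaPoly_edge`).
--
-- Interlacing of these families is proved by induction on the corank. The relation used is
-- `ProperPos`, a bound on the difference of arguments in the upper half plane: with one polynomial
-- fixed it is a convex cone condition on the other, also satisfied by zero, so it passes to sums
-- without bookkeeping of degrees. Since the descent thresholds `D` increase with the index, each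
-- recursion step compares initial segments and tails of sums, and the relations survive
-- (`TransferInterlacing.succ`). The four claims about γ-polynomials are comparisons of the same
-- kind.
--
-- Actual root inequalities come back through a Hermite–Biehler argument: the sum of the arguments
-- of `z - r` over the roots `r` tends, at a real point, to π times the number of roots to its right
-- (`interlaces_of_im_nonneg`). For the Chow polynomials themselves, proper position is carried
-- through the substitution `y = x / (1 + x) ^ 2` (`ProperPos.interlaces_of_isGammaPoly`).

noncomputable section

/-! ### Proper position, evaluated on the upper half plane -/

/-- The values of `f` and `g` at each point `z` of the upper half plane satisfy
`0 ≤ arg (g z) - arg (f z) ≤ arg z`. For nonzero `f`, `g` with nonnegative coefficients and only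
real zeros this is the interlacing relation `f ⪯ g`. -/
def ProperPos (f g : ℝ[X]) : Prop :=
  ∀ z : ℂ, 0 < z.im →
    0 ≤ (aeval z g * (starRingEnd ℂ) (aeval z f)).im ∧
    0 ≤ (z * aeval z f * (starRingEnd ℂ) (aeval z g)).im

/-- `f` is zero or has no zeros in the upper half plane. -/
def StableOrZero (f : ℝ[X]) : Prop := f = 0 ∨ ∀ z : ℂ, 0 < z.im → aeval z f ≠ 0

namespace ProperPos

theorem refl (f : ℝ[X]) : ProperPos f f := by
  intro z hz
  rw [mul_assoc, Complex.mul_conj]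
  refine ⟨by simp, ?_⟩
  rw [Complex.im_mul_ofReal]
  exact mul_nonneg hz.le (Complex.normSq_nonneg _)

theorem zero_left (f : ℝ[X]) : ProperPos 0 f := fun z _ => by simp

theorem zero_right (f : ℝ[X]) : ProperPos f 0 := fun z _ => by simp

theorem add_left {f g h : ℝ[X]} (hf : ProperPos f h) (hg : ProperPos g h) :
    ProperPos (f + g) h := by
  intro z hz
  obtain ⟨a, b⟩ := hf z hz
  obtain ⟨c, d⟩ := hg z hz
  simp only [map_add, mul_add, add_mul, Complex.add_im]
  exact ⟨add_nonneg a c, add_nonneg b d⟩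

theorem add_right {f g h : ℝ[X]} (hf : ProperPos h f) (hg : ProperPos h g) :
    ProperPos h (f + g) := by
  intro z hz
  obtain ⟨a, b⟩ := hf z hz
  obtain ⟨c, d⟩ := hg z hz
  simp only [map_add, mul_add, add_mul, Complex.add_im]
  exact ⟨add_nonneg a c, add_nonneg b d⟩

theorem C_mul_left {f g : ℝ[X]} {c : ℝ} (hc : 0 ≤ c) (h : ProperPos f g) :
    ProperPos (C c * f) g := by
  intro z hz
  obtain ⟨a, b⟩ := h z hz
  have e1 : aeval z g * (starRingEnd ℂ) (aeval z (C c * f)) =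
      (c : ℂ) * (aeval z g * (starRingEnd ℂ) (aeval z f)) := by
    simp only [map_mul, aeval_C, Complex.coe_algebraMap, Complex.conj_ofReal]; ring
  have e2 : z * aeval z (C c * f) * (starRingEnd ℂ) (aeval z g) =
      (c : ℂ) * (z * aeval z f * (starRingEnd ℂ) (aeval z g)) := by
    simp only [map_mul, aeval_C, Complex.coe_algebraMap]; ring
  rw [e1, e2, Complex.im_ofReal_mul, Complex.im_ofReal_mul]
  exact ⟨mul_nonneg hc a, mul_nonneg hc b⟩

theorem C_mul_right {f g : ℝ[X]} {c : ℝ} (hc : 0 ≤ c) (h : ProperPos f g) :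
    ProperPos f (C c * g) := by
  intro z hz
  obtain ⟨a, b⟩ := h z hz
  have e1 : aeval z (C c * g) * (starRingEnd ℂ) (aeval z f) =
      (c : ℂ) * (aeval z g * (starRingEnd ℂ) (aeval z f)) := by
    simp only [map_mul, aeval_C, Complex.coe_algebraMap]; ring
  have e2 : z * aeval z f * (starRingEnd ℂ) (aeval z (C c * g)) =
      (c : ℂ) * (z * aeval z f * (starRingEnd ℂ) (aeval z g)) := by
    simp only [map_mul, aeval_C, Complex.coe_algebraMap, Complex.conj_ofReal]; ring
  rw [e1, e2, Complex.im_ofReal_mul, Complex.im_ofReal_mul]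
  exact ⟨mul_nonneg hc a, mul_nonneg hc b⟩

/-- Multiplication by `z` rotates by `arg z`, which exchanges the two bounds on the difference of
arguments. -/
theorem X_mul {f g : ℝ[X]} (h : ProperPos f g) : ProperPos g (X * f) := by
  intro z hz
  obtain ⟨a, b⟩ := h z hz
  refine ⟨by simpa using b, ?_⟩
  have e : z * aeval z g * (starRingEnd ℂ) (aeval z (X * f)) =
      ((Complex.normSq z : ℝ) : ℂ) * (aeval z g * (starRingEnd ℂ) (aeval z f)) := by
    rw [← Complex.mul_conj]; simp only [map_mul, aeval_X]; ring
  rw [e, Complex.im_ofReal_mul]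
  exact mul_nonneg (Complex.normSq_nonneg _) a

theorem X_mul_X_mul {f g : ℝ[X]} (h : ProperPos f g) : ProperPos (X * f) (X * g) :=
  h.X_mul.X_mul

theorem sum_left {ι : Type*} (s : Finset ι) {f : ι → ℝ[X]} {g : ℝ[X]}
    (h : ∀ i ∈ s, ProperPos (f i) g) : ProperPos (∑ i ∈ s, f i) g := by
  classical
  induction s using Finset.induction_on with
  | empty => simpa using zero_left g
  | insert a s ha ih =>
    rw [Finset.sum_insert ha]
    exact (h a (by simp)).add_left (ih fun i hi => h i (by simp [hi]))

theorem sum_right {ι : Type*} (s : Finset ι) {f : ι → ℝ[X]} {g : ℝ[X]}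
    (h : ∀ i ∈ s, ProperPos g (f i)) : ProperPos g (∑ i ∈ s, f i) := by
  classical
  induction s using Finset.induction_on with
  | empty => simpa using zero_right g
  | insert a s ha ih =>
    rw [Finset.sum_insert ha]
    exact (h a (by simp)).add_right (ih fun i hi => h i (by simp [hi]))

/-- If `A` precedes `B` up to a common part, then the sum of an increasing family over `A` is in
proper position with its sum over `B`. -/
theorem sum_sum {f : ℕ → ℝ[X]} (h : ∀ i j, i ≤ j → ProperPos (f i) (f j)) {A B : Finset ℕ}
    (hAB : ∀ i ∈ A, ∀ j ∈ B, i ≤ j ∨ (i ∈ B ∧ j ∈ A)) :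
    ProperPos (∑ i ∈ A, f i) (∑ j ∈ B, f j) := by
  -- The common part is compared with itself by reflexivity. Every remaining pair has an index
  -- outside the intersection, so the hypothesis puts it in increasing order.
  have key : ProperPos (∑ i ∈ A ∩ B, f i) (∑ j ∈ B, f j) := by
    rw [← Finset.sum_inter_add_sum_sdiff B A f, Finset.inter_comm A B]
    refine (refl _).add_right (sum_left _ fun i hi => sum_right _ fun j hj => ?_)
    rw [Finset.mem_inter] at hi
    rw [Finset.mem_sdiff] at hj
    exact h i j ((hAB i hi.2 j hj.1).resolve_right fun h => hj.2 h.2)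
  rw [← Finset.sum_inter_add_sum_sdiff A B f]
  refine key.add_left (sum_left _ fun i hi => sum_right _ fun j hj => ?_)
  rw [Finset.mem_sdiff] at hi
  exact h i j ((hAB i hi.1 j hj).resolve_right fun h => hi.2 h.1)

end ProperPos

namespace StableOrZero

theorem zero : StableOrZero 0 := Or.inl rfl

theorem one : StableOrZero 1 := Or.inr fun z _ => by simp

theorem C_mul {f : ℝ[X]} (c : ℝ) (h : StableOrZero f) : StableOrZero (C c * f) := by
  by_cases hc : c = 0
  · left; simp [hc]
  rcases h with rfl | h
  · left; simp
  · right
    intro z hz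
    simp only [map_mul, aeval_C, Complex.coe_algebraMap]
    exact mul_ne_zero (by exact_mod_cast hc) (h z hz)

theorem X_mul {f : ℝ[X]} (h : StableOrZero f) : StableOrZero (X * f) := by
  rcases h with rfl | h
  · left; simp
  · right
    intro z hz
    simp only [map_mul, aeval_X]
    refine mul_ne_zero ?_ (h z hz)
    rintro rfl
    simp at hz

/-- At a zero of the sum the values are opposite, so the second inequality of `ProperPos` would read
`-(im z) |f z|² ≥ 0`. Proper position alone does not give stability, because it is reflexive. -/
theorem add {f g : ℝ[X]} (hf : StableOrZero f) (hg : StableOrZero g) (h : ProperPos f g) :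
    StableOrZero (f + g) := by
  rcases hf with rfl | hf
  · simpa using hg
  rcases hg with rfl | hg
  · right; simpa using hf
  right
  intro z hz h0
  rw [map_add] at h0
  have hb := (h z hz).2
  rw [eq_neg_of_add_eq_zero_right h0, map_neg, mul_neg, mul_assoc, Complex.mul_conj,
    Complex.neg_im, Complex.im_mul_ofReal] at hb
  have := mul_pos hz (Complex.normSq_pos.mpr (hf z hz))
  linarith

theorem sum (s : Finset ℕ) {f : ℕ → ℝ[X]} (hf : ∀ i ∈ s, StableOrZero (f i))
    (h : ∀ i ∈ s, ∀ j ∈ s, i < j → ProperPos (f i) (f j)) : StableOrZero (∑ i ∈ s, f i) := by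
  induction s using Finset.induction_on_max with
  | empty => simpa using zero
  | insert a s ha ih =>
    rw [Finset.sum_insert fun h => (ha a h).false, add_comm]
    refine add (ih (fun i hi => hf i (by simp [hi]))
      fun i hi j hj => h i (by simp [hi]) j (by simp [hj])) (hf a (by simp)) ?_
    exact ProperPos.sum_left _ fun i hi => h i (by simp [hi]) a (by simp) (ha i hi)

end StableOrZero

/-! ### Descent generating polynomials of rank-uniform data -/

section Transfer

variable (N : ℕ) (w D : ℕ → ℕ → ℕ)

mutual

/-- The generating polynomial, by number of descents, of label sequences with isolated descents and
without a descent in the first position, whose first label has index `i` in corank `m + 1`. -/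
def noFirstDescentPoly : ℕ → ℕ → ℝ[X]
  | 0, _ => 1
  | m + 1, i => ∑ j ∈ (Finset.range N).filter (fun j => ¬ j ≤ D (m + 1) i),
      C (w m j : ℝ) * isolatedDescentPoly m j

/-- The generating polynomial, by number of descents, of label sequences with isolated descents
whose first label has index `i` in corank `m + 1`. -/
def isolatedDescentPoly : ℕ → ℕ → ℝ[X]
  | 0, _ => 1
  | m + 1, i => ∑ j ∈ (Finset.range N).filter (fun j => ¬ j ≤ D (m + 1) i),
      C (w m j : ℝ) * isolatedDescentPoly m j +
      X * ∑ j ∈ (Finset.range N).filter (fun j => j ≤ D (m + 1) i),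
        C (w m j : ℝ) * noFirstDescentPoly m j

end

local notation "G" => noFirstDescentPoly N w D
local notation "F" => isolatedDescentPoly N w D

/-- The weighted sum of `isolatedDescentPoly` over the indices that are not at most `b`. -/
def upperSum (m b : ℕ) : ℝ[X] :=
  ∑ j ∈ (Finset.range N).filter (fun j => ¬ j ≤ b), C (w m j : ℝ) * F m j

/-- The weighted sum of `noFirstDescentPoly` over the indices at most `a`. -/
def lowerSum (m a : ℕ) : ℝ[X] :=
  ∑ j ∈ (Finset.range N).filter (fun j => j ≤ a), C (w m j : ℝ) * G m j

theorem noFirstDescentPoly_zero (i : ℕ) : G 0 i = 1 := by rw [noFirstDescentPoly]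

theorem isolatedDescentPoly_zero (i : ℕ) : F 0 i = 1 := by rw [isolatedDescentPoly]

theorem noFirstDescentPoly_succ (m i : ℕ) :
    G (m + 1) i = upperSum N w D m (D (m + 1) i) := by rw [noFirstDescentPoly, upperSum]

theorem isolatedDescentPoly_succ (m i : ℕ) :
    F (m + 1) i = upperSum N w D m (D (m + 1) i) + X * lowerSum N w D m (D (m + 1) i) := by
  rw [isolatedDescentPoly, upperSum, lowerSum]

theorem C_natCast_mul_properPos {f g : ℝ[X]} (a b : ℕ) (h : ProperPos f g) :
    ProperPos (C (a : ℝ) * f) (C (b : ℝ) * g) :=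
  (h.C_mul_left a.cast_nonneg).C_mul_right b.cast_nonneg

/-- The interlacing relations in corank `m + 1`. -/
structure TransferInterlacing (m : ℕ) : Prop where
  upper : ∀ i j, i ≤ j → ProperPos (F m i) (F m j)
  lower : ∀ i j, i ≤ j → ProperPos (G m i) (G m j)
  -- This is stated for sums over sets because nothing is claimed for single terms `G i`, `F j` with
  -- `j < i`. Such pairs are allowed only inside the overlap of `A` and `B`.
  cross : ∀ A B : Finset ℕ, (∀ i ∈ A, ∀ j ∈ B, i ≤ j ∨ (i ∈ B ∧ j ∈ A)) →
    ProperPos (∑ j ∈ A, C (w m j : ℝ) * G m j) (∑ j ∈ B, C (w m j : ℝ) * F m j)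
  upper_stable : ∀ i, StableOrZero (F m i)
  lower_stable : ∀ i, StableOrZero (G m i)

variable {N w D}

namespace TransferInterlacing

variable {m : ℕ}

theorem upperSum_mono (h : TransferInterlacing N w D m) {a b : ℕ} (hab : a ≤ b) :
    ProperPos (upperSum N w D m a) (upperSum N w D m b) := by
  refine ProperPos.sum_sum (fun i j hij => C_natCast_mul_properPos _ _ (h.upper i j hij)) ?_
  intro i hi j hj
  simp only [Finset.mem_filter, Finset.mem_range] at *
  omega

/-- No relation between `a` and `b` is needed: if `j < i` with `i ≤ a` and `b < j`, then both
indices lie in both ranges. -/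
theorem lowerSum_upperSum (h : TransferInterlacing N w D m) (a b : ℕ) :
    ProperPos (lowerSum N w D m a) (upperSum N w D m b) := by
  refine h.cross _ _ ?_
  intro i hi j hj
  simp only [Finset.mem_filter, Finset.mem_range] at *
  omega

theorem upperSum_stable (h : TransferInterlacing N w D m) (a : ℕ) :
    StableOrZero (upperSum N w D m a) :=
  StableOrZero.sum _ (fun i _ => (h.upper_stable i).C_mul _)
    fun i _ j _ hij => C_natCast_mul_properPos _ _ (h.upper i j hij.le)

theorem lowerSum_stable (h : TransferInterlacing N w D m) (a : ℕ) :
    StableOrZero (lowerSum N w D m a) :=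
  StableOrZero.sum _ (fun i _ => (h.lower_stable i).C_mul _)
    fun i _ j _ hij => C_natCast_mul_properPos _ _ (h.lower i j hij.le)

/-- Raising the threshold from `a` to `b` moves the middle block from the tail to the initial
segment. With `r` the tail beyond `b`, `s` the initial segment up to `a`, and `p`, `q` the middle
block formed with `F` and `G`, the claim is `r + X s + p ⪯ r + X s + X q`. It follows term by term
from `p ⪯ r`, `s ⪯ p`, `q ⪯ p`, `q ⪯ r`, `s ⪯ q` and the shift `X_mul`. -/
theorem upper_succ (h : TransferInterlacing N w D m) {a b : ℕ} (hab : a ≤ b) :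
    ProperPos (upperSum N w D m a + X * lowerSum N w D m a)
      (upperSum N w D m b + X * lowerSum N w D m b) := by
  set p := ∑ j ∈ (Finset.range N).filter (fun j => a < j ∧ j ≤ b), C (w m j : ℝ) * F m j with hp
  set q := ∑ j ∈ (Finset.range N).filter (fun j => a < j ∧ j ≤ b), C (w m j : ℝ) * G m j with hq
  have hU : upperSum N w D m a = upperSum N w D m b + p := by
    rw [upperSum, upperSum, hp, ← Finset.sum_union]
    · congr 1; ext j; simp only [Finset.mem_union, Finset.mem_filter, Finset.mem_range]; omega
    · rw [Finset.disjoint_left]; intro j; simp only [Finset.mem_filter, Finset.mem_range]; omega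
  have hL : lowerSum N w D m b = lowerSum N w D m a + q := by
    rw [lowerSum, lowerSum, hq, ← Finset.sum_union]
    · congr 1; ext j; simp only [Finset.mem_union, Finset.mem_filter, Finset.mem_range]; omega
    · rw [Finset.disjoint_left]; intro j; simp only [Finset.mem_filter, Finset.mem_range]; omega
  have hpr : ProperPos p (upperSum N w D m b) := by
    refine ProperPos.sum_sum (fun i j hij => C_natCast_mul_properPos _ _ (h.upper i j hij)) ?_
    intro i hi j hj
    simp only [Finset.mem_filter, Finset.mem_range] at *
    omega
  have hsp : ProperPos (lowerSum N w D m a) p := by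
    refine h.cross _ _ ?_
    intro i hi j hj
    simp only [Finset.mem_filter, Finset.mem_range] at *
    omega
  have hqp : ProperPos q p := by
    refine h.cross _ _ ?_
    intro i hi j hj
    exact Or.inr ⟨hi, hj⟩
  have hqr : ProperPos q (upperSum N w D m b) := by
    refine h.cross _ _ ?_
    intro i hi j hj
    simp only [Finset.mem_filter, Finset.mem_range] at *
    omega
  have hsq : ProperPos (lowerSum N w D m a) q := by
    refine ProperPos.sum_sum (fun i j hij => C_natCast_mul_properPos _ _ (h.lower i j hij)) ?_
    intro i hi j hj
    simp only [Finset.mem_filter, Finset.mem_range] at *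
    omega
  rw [hU, hL, mul_add, ← add_assoc, add_right_comm]
  refine ((ProperPos.refl _).add_left ?_).add_right ((hqr.X_mul.add_left ?_).add_left hqp.X_mul)
  · exact hpr.add_right hsp.X_mul
  · exact hsq.X_mul_X_mul

theorem succ (h : TransferInterlacing N w D m) (hD : Monotone (D (m + 1))) :
    TransferInterlacing N w D (m + 1) where
  upper i j hij := by
    rw [isolatedDescentPoly_succ, isolatedDescentPoly_succ]
    exact h.upper_succ (hD hij)
  lower i j hij := by
    rw [noFirstDescentPoly_succ, noFirstDescentPoly_succ]
    exact h.upperSum_mono (hD hij)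
  cross A B hAB := by
    simp only [isolatedDescentPoly_succ, noFirstDescentPoly_succ, mul_add, Finset.sum_add_distrib]
    refine ProperPos.add_right ?_ (ProperPos.sum_left _ fun i _ => ProperPos.sum_right _ fun j _ => ?_)
    · exact ProperPos.sum_sum
        (fun i j hij => C_natCast_mul_properPos _ _ (h.upperSum_mono (hD hij))) hAB
    · exact C_natCast_mul_properPos _ _ (h.lowerSum_upperSum _ _).X_mul
  upper_stable i := by
    rw [isolatedDescentPoly_succ]
    exact (h.upperSum_stable _).add (h.lowerSum_stable _).X_mul (h.lowerSum_upperSum _ _).X_mul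
  lower_stable i := by
    rw [noFirstDescentPoly_succ]
    exact h.upperSum_stable _

end TransferInterlacing

variable (N w D)

theorem transferInterlacing_zero : TransferInterlacing N w D 0 where
  upper i j _ := by simpa only [isolatedDescentPoly_zero] using ProperPos.refl 1
  lower i j _ := by simpa only [noFirstDescentPoly_zero] using ProperPos.refl 1
  cross A B _ := by
    simp only [isolatedDescentPoly_zero, noFirstDescentPoly_zero]
    exact ProperPos.sum_left _ fun i _ => ProperPos.sum_right _ fun j _ =>
      C_natCast_mul_properPos _ _ (ProperPos.refl 1)
  upper_stable i := by simpa only [isolatedDescentPoly_zero] using StableOrZero.one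
  lower_stable i := by simpa only [noFirstDescentPoly_zero] using StableOrZero.one

theorem transferInterlacing (hD : ∀ m, Monotone (D m)) (m : ℕ) : TransferInterlacing N w D m := by
  induction m with
  | zero => exact transferInterlacing_zero N w D
  | succ m ih => exact ih.succ (hD (m + 1))

-- Sums over all labels, and their relations within a corank and between consecutive coranks

/-- The generating polynomial of all label sequences from corank `m` with isolated descents. -/
def totalPoly : ℕ → ℝ[X]
  | 0 => 1
  | m + 1 => ∑ j ∈ Finset.range N, C (w m j : ℝ) * F m j

/-- The generating polynomial of all label sequences from corank `m` with isolated descents and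
without a descent in the first position. -/
def totalNoFirstDescentPoly : ℕ → ℝ[X]
  | 0 => 1
  | m + 1 => ∑ j ∈ Finset.range N, C (w m j : ℝ) * G m j

variable {N w D}

/-- Label indices start at 1, so the threshold 0 removes only an index of weight zero. The full sum
thus becomes a tail, comparable with every other tail. -/
theorem totalPoly_succ_eq_upperSum (hw : ∀ m, w m 0 = 0) (m : ℕ) :
    totalPoly N w D (m + 1) = upperSum N w D m 0 := by
  rw [totalPoly, upperSum, Finset.sum_filter]
  refine Finset.sum_congr rfl fun j _ => ?_
  split_ifs with h
  · obtain rfl : j = 0 := by omega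
    simp [hw]
  · rfl

theorem totalNoFirstDescentPoly_succ_eq_lowerSum (m : ℕ) :
    totalNoFirstDescentPoly N w D (m + 1) = lowerSum N w D m N := by
  rw [totalNoFirstDescentPoly, lowerSum, Finset.filter_true_of_mem]
  intro j hj
  exact (Finset.mem_range.mp hj).le

theorem totalPoly_stable (hw : ∀ m, w m 0 = 0) (hD : ∀ m, Monotone (D m)) (m : ℕ) :
    StableOrZero (totalPoly N w D m) := by
  cases m with
  | zero => exact StableOrZero.one
  | succ m =>
    rw [totalPoly_succ_eq_upperSum hw]
    exact (transferInterlacing N w D hD m).upperSum_stable _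

theorem totalNoFirstDescentPoly_stable (hD : ∀ m, Monotone (D m)) (m : ℕ) :
    StableOrZero (totalNoFirstDescentPoly N w D m) := by
  cases m with
  | zero => exact StableOrZero.one
  | succ m =>
    rw [totalNoFirstDescentPoly_succ_eq_lowerSum]
    exact (transferInterlacing N w D hD m).lowerSum_stable _

theorem properPos_noFirstDescent_total (hw : ∀ m, w m 0 = 0) (hD : ∀ m, Monotone (D m)) (m : ℕ) :
    ProperPos (totalNoFirstDescentPoly N w D m) (totalPoly N w D m) := by
  cases m with
  | zero => exact ProperPos.refl _
  | succ m =>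
    rw [totalPoly_succ_eq_upperSum hw, totalNoFirstDescentPoly_succ_eq_lowerSum]
    exact (transferInterlacing N w D hD m).lowerSum_upperSum _ _

theorem properPos_total_noFirstDescent_succ (hw : ∀ m, w m 0 = 0) (hD : ∀ m, Monotone (D m))
    (m : ℕ) : ProperPos (totalPoly N w D m) (totalNoFirstDescentPoly N w D (m + 1)) := by
  rw [totalNoFirstDescentPoly]
  refine ProperPos.sum_right _ fun j _ => ProperPos.C_mul_right (Nat.cast_nonneg _) ?_
  cases m with
  | zero => rw [noFirstDescentPoly_zero]; exact ProperPos.refl _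
  | succ m =>
    rw [noFirstDescentPoly_succ, totalPoly_succ_eq_upperSum hw]
    exact (transferInterlacing N w D hD m).upperSum_mono (Nat.zero_le _)

/-- Each summand is a tail plus `X` times an initial segment. The full sum precedes the tail by
monotonicity, and it precedes the other part because initial segments precede tails. -/
theorem properPos_total_succ (hw : ∀ m, w m 0 = 0) (hD : ∀ m, Monotone (D m)) (m : ℕ) :
    ProperPos (totalPoly N w D m) (totalPoly N w D (m + 1)) := by
  rw [totalPoly.eq_2]
  refine ProperPos.sum_right _ fun j _ => ProperPos.C_mul_right (Nat.cast_nonneg _) ?_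
  cases m with
  | zero => rw [isolatedDescentPoly_zero]; exact ProperPos.refl _
  | succ m =>
    rw [isolatedDescentPoly_succ, totalPoly_succ_eq_upperSum hw]
    have h := transferInterlacing N w D hD m
    exact (h.upperSum_mono (Nat.zero_le _)).add_right (h.lowerSum_upperSum _ _).X_mul

theorem properPos_noFirstDescent_succ (hD : ∀ m, Monotone (D m)) (m : ℕ) :
    ProperPos (totalNoFirstDescentPoly N w D m) (totalNoFirstDescentPoly N w D (m + 1)) := by
  rw [totalNoFirstDescentPoly.eq_2]
  refine ProperPos.sum_right _ fun j _ => ProperPos.C_mul_right (Nat.cast_nonneg _) ?_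
  cases m with
  | zero => rw [noFirstDescentPoly_zero]; exact ProperPos.refl _
  | succ m =>
    rw [noFirstDescentPoly_succ, totalNoFirstDescentPoly_succ_eq_lowerSum]
    exact (transferInterlacing N w D hD m).lowerSum_upperSum _ _

/-! Nonnegativity and degrees -/

theorem isolatedDescentPoly_coeff_nonneg (m : ℕ) :
    (∀ i k, 0 ≤ (F m i).coeff k) ∧ (∀ i k, 0 ≤ (G m i).coeff k) := by
  induction m with
  | zero =>
    simp only [isolatedDescentPoly_zero, noFirstDescentPoly_zero, coeff_one]
    constructor <;> intro i k <;> split_ifs <;> norm_num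
  | succ m ih =>
    have hU : ∀ b k, 0 ≤ (upperSum N w D m b).coeff k := fun b k => by
      rw [upperSum, finsetSum_coeff]
      exact Finset.sum_nonneg fun j _ => by
        rw [coeff_C_mul]; exact mul_nonneg (Nat.cast_nonneg _) (ih.1 j k)
    have hL : ∀ b k, 0 ≤ (lowerSum N w D m b).coeff k := fun b k => by
      rw [lowerSum, finsetSum_coeff]
      exact Finset.sum_nonneg fun j _ => by
        rw [coeff_C_mul]; exact mul_nonneg (Nat.cast_nonneg _) (ih.2 j k)
    simp only [isolatedDescentPoly_succ, noFirstDescentPoly_succ]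
    refine ⟨fun i k => ?_, fun i k => hU _ k⟩
    rw [coeff_add]
    refine add_nonneg (hU _ k) ?_
    cases k with
    | zero => simp
    | succ k => rw [coeff_X_mul]; exact hL _ k

theorem totalPoly_coeff_nonneg (m k : ℕ) : 0 ≤ (totalPoly N w D m).coeff k := by
  cases m with
  | zero => rw [totalPoly, coeff_one]; split_ifs <;> norm_num
  | succ m =>
    rw [totalPoly, finsetSum_coeff]
    exact Finset.sum_nonneg fun j _ => by
      rw [coeff_C_mul]
      exact mul_nonneg (Nat.cast_nonneg _) ((isolatedDescentPoly_coeff_nonneg m).1 j k)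

theorem totalNoFirstDescentPoly_coeff_nonneg (m k : ℕ) :
    0 ≤ (totalNoFirstDescentPoly N w D m).coeff k := by
  cases m with
  | zero => rw [totalNoFirstDescentPoly, coeff_one]; split_ifs <;> norm_num
  | succ m =>
    rw [totalNoFirstDescentPoly, finsetSum_coeff]
    exact Finset.sum_nonneg fun j _ => by
      rw [coeff_C_mul]
      exact mul_nonneg (Nat.cast_nonneg _) ((isolatedDescentPoly_coeff_nonneg m).2 j k)

end Transfer


/-! ### From the upper half plane to interlacing zeros -/

section HermiteBiehler

open Filter Topology Complex

theorem aeval_ne_zero_of_im_ne_zero {f : ℝ[X]} (hf : ∀ z : ℂ, 0 < z.im → aeval z f ≠ 0) {z : ℂ}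
    (hz : z.im ≠ 0) : aeval z f ≠ 0 := by
  rcases lt_or_gt_of_ne hz with h | h
  · intro h0
    refine hf ((starRingEnd ℂ) z) (by simpa using h) ?_
    rw [aeval_conj, h0, map_zero]
  · exact hf z h

/-- By conjugation all complex zeros are real, so every irreducible factor has a real zero and is
linear. -/
theorem splits_of_forall_aeval_ne_zero {f : ℝ[X]} (hf : ∀ z : ℂ, 0 < z.im → aeval z f ≠ 0) :
    f.Splits := by
  induction f using WfDvdMonoid.induction_on_irreducible with
  | zero => exact Splits.zero
  | unit u hu => exact hu.splits
  | mul f q hf0 hq ih =>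
  refine Splits.mul (Splits.of_degree_eq_one ?_)
    (ih fun z hz h0 => hf z hz (by rw [map_mul, h0, mul_zero]))
  obtain ⟨z, hz⟩ := IsAlgClosed.exists_aeval_eq_zero ℂ q (degree_pos_of_irreducible hq).ne'
  have him : z.im = 0 := by
    by_contra h
    exact aeval_ne_zero_of_im_ne_zero hf h (by rw [map_mul, hz, zero_mul])
  have hre : z = ((z.re : ℝ) : ℂ) := Complex.ext (by simp) (by simp [him])
  refine degree_eq_one_of_irreducible_of_root (x := z.re) hq ?_
  rw [hre] at hz
  have := aeval_algebraMap_apply ℂ z.re q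
  rw [Complex.coe_algebraMap, hz] at this
  simpa [IsRoot.def] using this.symm

/-- The sum of the arguments of `z - r` for `r` in `S`. -/
def argSum (S : Multiset ℝ) (z : ℂ) : ℝ := (S.map fun r : ℝ => arg (z - (r : ℂ))).sum

theorem exists_prod_eq_mul_exp_argSum (S : Multiset ℝ) {z : ℂ} (hz : 0 < z.im) :
    ∃ ρ : ℝ, 0 < ρ ∧ (S.map fun r : ℝ => z - (r : ℂ)).prod = ρ * exp (argSum S z * I) := by
  induction S using Multiset.induction_on with
  | empty => exact ⟨1, one_pos, by simp [argSum]⟩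
  | cons r S ih =>
    obtain ⟨ρ, hρ, h⟩ := ih
    have hne : z - (r : ℂ) ≠ 0 := by
      intro h0
      have := congrArg Complex.im h0
      simp at this
      exact hz.ne' this
    refine ⟨‖z - (r : ℂ)‖ * ρ, mul_pos (norm_pos_iff.mpr hne) hρ, ?_⟩
    rw [Multiset.map_cons, Multiset.prod_cons, h]
    nth_rewrite 1 [← norm_mul_exp_arg_mul_I (z - (r : ℂ))]
    rw [argSum, argSum, Multiset.map_cons, Multiset.sum_cons]
    push_cast
    rw [add_mul, exp_add]
    ring

theorem aeval_eq_prod_roots_of_splits {f : ℝ[X]} (hf : f.Splits) (z : ℂ) :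
    aeval z f = f.leadingCoeff * (f.roots.map fun r : ℝ => z - (r : ℂ)).prod := by
  conv_lhs => rw [hf.eq_prod_roots]
  rw [map_mul, aeval_C, map_multiset_prod, Multiset.map_map]
  simp

theorem continuousOn_argSum (S : Multiset ℝ) : ContinuousOn (argSum S) {z : ℂ | 0 < z.im} := by
  induction S using Multiset.induction_on with
  | empty =>
    have : argSum 0 = fun _ => 0 := by ext; simp [argSum]
    rw [this]
    exact continuousOn_const
  | cons r S ih =>
    have : argSum (r ::ₘ S) = fun z => arg (z - (r : ℂ)) + argSum S z := by
      ext z; simp [argSum]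
    rw [this]
    refine ContinuousOn.add (fun z hz => ?_) ih
    refine ContinuousAt.continuousWithinAt ?_
    refine ContinuousAt.comp (f := fun z : ℂ => z - (r : ℂ)) (g := arg) ?_ (by fun_prop)
    refine continuousAt_arg ?_
    rw [mem_slitPlane_iff]
    right
    simpa using (ne_of_gt hz)

/-- As `z` descends to `t`, the argument of `z - r` tends to π if `r > t`, since a negative real is
approached from above, and to 0 if `r < t`. -/
theorem tendsto_argSum (S : Multiset ℝ) {t : ℝ} (ht : t ∉ S) :
    Tendsto (fun ε : ℝ => argSum S (t + ε * I)) (𝓝[>] 0)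
      (𝓝 (S.countP (t < ·) * Real.pi)) := by
  induction S using Multiset.induction_on with
  | empty => simp [argSum]
  | cons r S ih =>
    rw [Multiset.mem_cons, not_or] at ht
    have : (fun ε : ℝ => argSum (r ::ₘ S) (t + ε * I)) =
        fun ε : ℝ => arg (t + ε * I - (r : ℂ)) + argSum S (t + ε * I) := by
      ext z; simp [argSum]
    rw [this]
    have hlim : Tendsto (fun ε : ℝ => (t + ε * I - (r : ℂ))) (𝓝[>] 0) (𝓝 ((t - r : ℝ) : ℂ)) := by
      have : Continuous (fun ε : ℝ => (t + ε * I - (r : ℂ))) := by fun_prop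
      have h := (this.tendsto 0).mono_left (nhdsWithin_le_nhds (s := Set.Ioi 0))
      simpa using h
    rcases lt_or_gt_of_ne ht.1 with h | h
    · rw [Multiset.countP_cons_of_pos _ h]
      push_cast
      rw [add_mul, one_mul, add_comm _ Real.pi]
      refine Tendsto.add ?_ (ih ht.2)
      refine (tendsto_arg_nhdsWithin_im_nonneg_of_re_neg_of_im_zero
        (z := ((t - r : ℝ) : ℂ)) (by simpa using h) (by simp)).comp ?_
      refine tendsto_nhdsWithin_iff.mpr ⟨hlim, ?_⟩
      filter_upwards [self_mem_nhdsWithin] with ε hε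
      simpa using (le_of_lt hε)
    · rw [Multiset.countP_cons_of_neg _ (not_lt.mpr h.le), ← zero_add (_ * Real.pi)]
      refine Tendsto.add ?_ (ih ht.2)
      have h0 : arg ((t - r : ℝ) : ℂ) = 0 := arg_ofReal_of_nonneg (by linarith)
      have hc : ContinuousAt arg ((t - r : ℝ) : ℂ) := continuousAt_arg (by
        rw [ofReal_mem_slitPlane]; linarith)
      have := hc.tendsto.comp hlim
      rwa [h0] at this

/-- A nonnegative sine fixes the difference only up to multiples of 2π. The branch is determined
near a real point to the right of all roots, where the difference is almost 0, and continuity on the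
connected half plane prevents a change of branch. -/
theorem argSum_sub_mem_Icc {S T : Multiset ℝ}
    (h : ∀ z : ℂ, 0 < z.im → 0 ≤ Real.sin (argSum T z - argSum S z)) {z : ℂ} (hz : 0 < z.im) :
    argSum T z - argSum S z ∈ Set.Icc 0 Real.pi := by
  have hpi := Real.pi_pos
  set ψ : ℂ → ℝ := fun z => argSum T z - argSum S z with hψ
  have hcont : ContinuousOn ψ {z : ℂ | 0 < z.im} :=
    (continuousOn_argSum T).sub (continuousOn_argSum S)
  have hconn : IsPreconnected {z : ℂ | 0 < z.im} :=
    (convex_halfSpace_im_gt 0).isPreconnected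
  obtain ⟨t, ht⟩ : ∃ t : ℝ, ∀ r ∈ S + T, r < t := by
    obtain ⟨t, ht⟩ := (S + T).toFinset.finite_toSet.bddAbove
    exact ⟨t + 1, fun r hr => lt_of_le_of_lt (ht (by simpa using hr)) (by linarith)⟩
  have htS : t ∉ S := fun h => (ht t (Multiset.mem_add.mpr (Or.inl h))).false
  have htT : t ∉ T := fun h => (ht t (Multiset.mem_add.mpr (Or.inr h))).false
  have hlim := (tendsto_argSum T htT).sub (tendsto_argSum S htS)
  rw [Multiset.countP_eq_zero.mpr fun r hr => not_lt.mpr (ht r (Multiset.mem_add.mpr (Or.inr hr))).le,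
    Multiset.countP_eq_zero.mpr fun r hr => not_lt.mpr (ht r (Multiset.mem_add.mpr (Or.inl hr))).le]
    at hlim
  simp only [Nat.cast_zero, zero_mul, sub_zero] at hlim
  have hev : ∀ᶠ ε : ℝ in 𝓝[>] 0, argSum T (t + ε * I) - argSum S (t + ε * I) ∈
      Set.Ioo (-(Real.pi / 2)) (Real.pi / 2) :=
    hlim (Ioo_mem_nhds (by linarith) (by linarith))
  obtain ⟨ε, hε, hε0⟩ := (hev.and self_mem_nhdsWithin).exists
  have hz0 : 0 < ((t : ℂ) + ε * I).im := by simpa using hε0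
  have hv0 : 0 ≤ ψ (t + ε * I) := by
    by_contra hneg
    push Not at hneg
    exact absurd (h _ hz0) (not_le.mpr (Real.sin_neg_of_neg_of_neg_pi_lt hneg (by
      have : -(Real.pi / 2) < ψ (t + ε * I) := hε.1; linarith)))
  have hv1 : ψ (t + ε * I) < Real.pi / 2 := hε.2
  constructor
  · by_contra hneg
    push Not at hneg
    obtain ⟨x, hx, hx'⟩ := hconn.intermediate_value (a := z) (b := t + ε * I) hz hz0 hcont
      -- The truncation at `-π/2` gives an attained value in `(-π, 0)`, where the sine is negative.
      -- Below, `3π/2` plays the same role for the interval `(π, 2π)`.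
      (show max (ψ z) (-(Real.pi / 2)) ∈ Set.Icc (ψ z) (ψ (t + ε * I)) from
        ⟨le_max_left _ _, max_le (by linarith) (by linarith)⟩)
    refine absurd (h x hx) (not_le.mpr ?_)
    change Real.sin (ψ x) < 0
    rw [hx']
    exact Real.sin_neg_of_neg_of_neg_pi_lt (max_lt hneg (by linarith))
      (lt_of_lt_of_le (by linarith) (le_max_right _ _))
  · by_contra hpos
    push Not at hpos
    obtain ⟨x, hx, hx'⟩ := hconn.intermediate_value (a := t + ε * I) (b := z) hz0 hz hcont
      (show min (ψ z) (3 * Real.pi / 2) ∈ Set.Icc (ψ (t + ε * I)) (ψ z) from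
        ⟨le_min (by linarith) (by linarith), min_le_left _ _⟩)
    refine absurd (h x hx) (not_le.mpr ?_)
    change Real.sin (ψ x) < 0
    rw [hx', ← Real.sin_sub_two_pi]
    refine Real.sin_neg_of_neg_of_neg_pi_lt ?_ ?_
    · have := min_le_right (ψ z) (3 * Real.pi / 2); linarith
    · have : Real.pi < min (ψ z) (3 * Real.pi / 2) := lt_min hpos (by linarith)
      linarith

/-- With positive leading coefficients the product has argument `argSum g.roots - argSum f.roots`
modulo 2π. Its boundary limit at `t` is π times the difference of the root counts, and this must lie
in `[0, π]`. -/
theorem countP_roots_of_im_nonneg {f g : ℝ[X]} (hf0 : 0 < f.leadingCoeff)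
    (hg0 : 0 < g.leadingCoeff) (hf : f.Splits) (hg : g.Splits)
    (h : ∀ z : ℂ, 0 < z.im → 0 ≤ (aeval z g * (starRingEnd ℂ) (aeval z f)).im) {t : ℝ}
    (htf : t ∉ f.roots) (htg : t ∉ g.roots) :
    f.roots.countP (t < ·) ≤ g.roots.countP (t < ·) ∧
      g.roots.countP (t < ·) ≤ f.roots.countP (t < ·) + 1 := by
  have hsin : ∀ z : ℂ, 0 < z.im → 0 ≤ Real.sin (argSum g.roots z - argSum f.roots z) := by
    intro z hz
    obtain ⟨ρ, hρ, e1⟩ := exists_prod_eq_mul_exp_argSum f.roots hz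
    obtain ⟨σ, hσ, e2⟩ := exists_prod_eq_mul_exp_argSum g.roots hz
    have key := h z hz
    rw [aeval_eq_prod_roots_of_splits hf, aeval_eq_prod_roots_of_splits hg, e1, e2] at key
    have e : ((g.leadingCoeff : ℂ) * (σ * exp (argSum g.roots z * I))) *
        (starRingEnd ℂ) ((f.leadingCoeff : ℂ) * (ρ * exp (argSum f.roots z * I))) =
        ((g.leadingCoeff * σ * (f.leadingCoeff * ρ) : ℝ) : ℂ) *
          exp ((argSum g.roots z - argSum f.roots z : ℝ) * I) := by
      rw [map_mul, map_mul, ← exp_conj, map_mul, conj_ofReal, conj_ofReal, conj_ofReal, conj_I]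
      push_cast
      rw [sub_mul, sub_eq_add_neg, exp_add, mul_neg]
      ring
    rw [e, im_ofReal_mul, exp_ofReal_mul_I_im] at key
    exact nonneg_of_mul_nonneg_right key (by positivity)
  have hlim := (tendsto_argSum g.roots htg).sub (tendsto_argSum f.roots htf)
  have hmem := isClosed_Icc.mem_of_tendsto hlim (b := 𝓝[>] 0) (s := Set.Icc 0 Real.pi) (by
    filter_upwards [self_mem_nhdsWithin] with ε hε
    exact argSum_sub_mem_Icc hsin (by simpa using hε))
  rw [← sub_mul] at hmem
  have h1 := nonneg_of_mul_nonneg_left hmem.1 Real.pi_pos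
  have h2 : (g.roots.countP (t < ·) : ℝ) - f.roots.countP (t < ·) ≤ 1 := by
    have := hmem.2
    by_contra hc
    push Not at hc
    nlinarith [Real.pi_pos]
  constructor
  · exact_mod_cast sub_nonneg.mp h1
  · have : (g.roots.countP (t < ·) : ℝ) ≤ f.roots.countP (t < ·) + 1 := by linarith
    exact_mod_cast this

theorem exists_antitone_map_range (S : Multiset ℝ) :
    ∃ α : ℕ → ℝ, (∀ i j, i ≤ j → j < S.card → α j ≤ α i) ∧
      S = (Multiset.range S.card).map α := by
  set L := S.sort (· ≥ ·) with hL
  have hlen : L.length = S.card := Multiset.length_sort _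
  refine ⟨fun i => L.getD i 0, ?_, ?_⟩
  · intro i j hij hj
    have hp : L.Pairwise (· ≥ ·) := Multiset.pairwise_sort S (· ≥ ·)
    rw [← hlen] at hj
    simp only [List.getD_eq_getElem _ _ hj, List.getD_eq_getElem _ _ (hij.trans_lt hj)]
    rcases hij.eq_or_lt with rfl | hlt
    · exact le_rfl
    · exact List.pairwise_iff_getElem.mp hp i j _ _ hlt
  · conv_lhs => rw [← Multiset.sort_eq S (· ≥ ·), ← hL]
    rw [← hlen, ← Multiset.coe_range, Multiset.map_coe, Multiset.coe_eq_coe]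
    refine List.Perm.of_eq (List.ext_getElem (by simp) fun i h1 h2 => ?_)
    simp only [List.getElem_map, List.getElem_range, List.getD_eq_getElem _ _ h1]

/-- A violated root inequality leaves a gap, and a non-root `t` chosen in that gap contradicts the
count condition. A `t` below all roots gives the relation between the degrees. -/
theorem interlaces_of_countP {f g : ℝ[X]} (hf0 : f ≠ 0) (hg0 : g ≠ 0) (hf : f.Splits)
    (hg : g.Splits)
    (h : ∀ t : ℝ, t ∉ f.roots → t ∉ g.roots → f.roots.countP (t < ·) ≤ g.roots.countP (t < ·) ∧
      g.roots.countP (t < ·) ≤ f.roots.countP (t < ·) + 1) : Interlaces f g := by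
  obtain ⟨α, hα, hfα⟩ := exists_antitone_map_range f.roots
  obtain ⟨β, hβ, hgβ⟩ := exists_antitone_map_range g.roots
  set n := f.roots.card with hn
  set m := g.roots.card with hm
  have hcf : ∀ t : ℝ, f.roots.countP (t < ·) = ((Finset.range n).filter (fun i => t < α i)).card := by
    intro t
    rw [hfα, Multiset.countP_map]
    rfl
  have hcg : ∀ t : ℝ, g.roots.countP (t < ·) = ((Finset.range m).filter (fun i => t < β i)).card := by
    intro t
    rw [hgβ, Multiset.countP_map]
    rfl
  have hpick : ∀ x y : ℝ, x < y → ∃ t, x < t ∧ t < y ∧ t ∉ f.roots ∧ t ∉ g.roots := by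
    intro x y hxy
    obtain ⟨t, ht, ht'⟩ := (Set.Ioo_infinite hxy).exists_notMem_finset (f.roots + g.roots).toFinset
    simp only [Multiset.mem_toFinset, Multiset.mem_add, not_or] at ht'
    exact ⟨t, ht.1, ht.2, ht'.1, ht'.2⟩
  have hmn : m = n ∨ m = n + 1 := by
    obtain ⟨x, hx⟩ := (f.roots + g.roots).toFinset.finite_toSet.bddBelow
    have hx' : ∀ r, r ∈ f.roots ∨ r ∈ g.roots → x ≤ r := fun r hr => hx (by
      simp only [Finset.mem_coe, Multiset.mem_toFinset, Multiset.mem_add]; exact hr)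
    obtain ⟨t, ht⟩ : ∃ t, t < x := ⟨x - 1, by linarith⟩
    have key := h t (fun h => absurd (hx' t (Or.inl h)) (not_le.mpr ht))
      (fun h => absurd (hx' t (Or.inr h)) (not_le.mpr ht))
    rw [Multiset.countP_eq_card.mpr fun r hr => ht.trans_le (hx' r (Or.inl hr)),
      Multiset.countP_eq_card.mpr fun r hr => ht.trans_le (hx' r (Or.inr hr))] at key
    omega
  right; right
  refine ⟨n, m, f.leadingCoeff, g.leadingCoeff, α, β, leadingCoeff_ne_zero.mpr hf0,
    leadingCoeff_ne_zero.mpr hg0, hmn, ?_, ?_, ?_, ?_⟩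
  · conv_lhs => rw [hf.eq_prod_roots, hfα, Multiset.map_map]
    rfl
  · conv_lhs => rw [hg.eq_prod_roots, hgβ, Multiset.map_map]
    rfl
  · intro i hi
    by_contra hlt
    push Not at hlt
    obtain ⟨t, h1, h2, h3, h4⟩ := hpick _ _ hlt
    have key := (h t h3 h4).1
    rw [hcf, hcg] at key
    have c1 : i + 1 ≤ ((Finset.range n).filter (fun i => t < α i)).card := by
      conv_lhs => rw [← Finset.card_range (i + 1)]
      refine Finset.card_le_card fun j hj => ?_
      rw [Finset.mem_range] at hj
      exact Finset.mem_filter.mpr ⟨Finset.mem_range.mpr (by omega),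
        h2.trans_le (hα j i (by omega) hi)⟩
    have c2 : ((Finset.range m).filter (fun i => t < β i)).card ≤ i := by
      conv_rhs => rw [← Finset.card_range i]
      refine Finset.card_le_card fun j hj => ?_
      rw [Finset.mem_filter, Finset.mem_range] at hj
      rw [Finset.mem_range]
      by_contra hij
      exact absurd (hβ i j (by omega) hj.1) (not_le.mpr (h1.trans hj.2))
    omega
  · intro i hi
    by_contra hlt
    push Not at hlt
    obtain ⟨t, h1, h2, h3, h4⟩ := hpick _ _ hlt
    have key := (h t h3 h4).2
    rw [hcf, hcg] at key
    have c1 : i + 2 ≤ ((Finset.range m).filter (fun i => t < β i)).card := by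
      conv_lhs => rw [← Finset.card_range (i + 2)]
      refine Finset.card_le_card fun j hj => ?_
      rw [Finset.mem_range] at hj
      exact Finset.mem_filter.mpr ⟨Finset.mem_range.mpr (by omega),
        h2.trans_le (hβ j (i + 1) (by omega) hi)⟩
    have c2 : ((Finset.range n).filter (fun i => t < α i)).card ≤ i := by
      conv_rhs => rw [← Finset.card_range i]
      refine Finset.card_le_card fun j hj => ?_
      rw [Finset.mem_filter, Finset.mem_range] at hj
      rw [Finset.mem_range]
      by_contra hij
      exact absurd (hα i j (by omega) hj.1) (not_le.mpr (h1.trans hj.2))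
    omega

/-- A form of the Hermite–Biehler (Hermite–Kakeya–Obreschkoff) theorem. -/
theorem interlaces_of_im_nonneg {f g : ℝ[X]} (hf0 : 0 < f.leadingCoeff)
    (hg0 : 0 < g.leadingCoeff) (hf : ∀ z : ℂ, 0 < z.im → aeval z f ≠ 0)
    (hg : ∀ z : ℂ, 0 < z.im → aeval z g ≠ 0)
    (h : ∀ z : ℂ, 0 < z.im → 0 ≤ (aeval z g * (starRingEnd ℂ) (aeval z f)).im) :
    Interlaces f g := by
  have hf' := splits_of_forall_aeval_ne_zero hf
  have hg' := splits_of_forall_aeval_ne_zero hg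
  exact interlaces_of_countP (leadingCoeff_ne_zero.mp hf0.ne') (leadingCoeff_ne_zero.mp hg0.ne')
    hf' hg' fun t h1 h2 => countP_roots_of_im_nonneg hf0 hg0 hf' hg' h h1 h2

end HermiteBiehler


/-! ### Gamma expansions and the substitution `y = x / (1 + x) ^ 2` -/

namespace IsGammaPoly

theorem one : IsGammaPoly 0 1 1 := by
  refine ⟨by simp, ?_⟩
  simp

theorem zero (d : ℕ) : IsGammaPoly d 0 0 := by
  refine ⟨by simp, ?_⟩
  simp

theorem add {d : ℕ} {f g f' g' : ℝ[X]} (h : IsGammaPoly d f g) (h' : IsGammaPoly d f' g') :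
    IsGammaPoly d (f + f') (g + g') := by
  refine ⟨(natDegree_add_le _ _).trans (max_le h.1 h'.1), ?_⟩
  conv_lhs => rw [h.2, h'.2]
  simp only [coeff_add, map_add, add_mul, Finset.sum_add_distrib]

theorem sum {ι : Type*} {d : ℕ} (s : Finset ι) {f g : ι → ℝ[X]}
    (h : ∀ i ∈ s, IsGammaPoly d (f i) (g i)) :
    IsGammaPoly d (∑ i ∈ s, f i) (∑ i ∈ s, g i) := by
  classical
  induction s using Finset.induction_on with
  | empty => simpa using zero d
  | insert a s ha ih =>
    rw [Finset.sum_insert ha, Finset.sum_insert ha]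
    exact (h a (by simp)).add (ih fun i hi => h i (by simp [hi]))

theorem one_add_X_mul {d : ℕ} {f g : ℝ[X]} (h : IsGammaPoly d f g) :
    IsGammaPoly (d + 1) ((1 + X) * f) g := by
  refine ⟨h.1.trans (by omega), ?_⟩
  have hsub : Finset.range (d / 2 + 1) ⊆ Finset.range ((d + 1) / 2 + 1) := by
    intro i; simp only [Finset.mem_range]; omega
  rw [← Finset.sum_subset hsub]
  · conv_lhs => rw [h.2]
    rw [Finset.mul_sum]
    refine Finset.sum_congr rfl fun i hi => ?_
    rw [Finset.mem_range] at hi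
    rw [show d + 1 - 2 * i = d - 2 * i + 1 by omega, pow_succ]
    ring
  -- For odd `d` the index range grows by one, but the new coefficient vanishes by the degree bound.
  · intro i _ hi
    rw [Finset.mem_range] at hi
    rw [coeff_eq_zero_of_natDegree_lt (h.1.trans_lt (by omega)), map_zero, zero_mul]

theorem X_mul {d : ℕ} {f g : ℝ[X]} (h : IsGammaPoly d f g) :
    IsGammaPoly (d + 2) (X * f) (X * g) := by
  refine ⟨natDegree_mul_le.trans ?_, ?_⟩
  · have := h.1
    have := natDegree_X_le (R := ℝ)
    omega
  · rw [show (d + 2) / 2 + 1 = d / 2 + 1 + 1 by omega, Finset.sum_range_succ']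
    conv_lhs => rw [h.2]
    simp only [coeff_X_mul, coeff_X_mul_zero, map_zero, zero_mul, add_zero, Finset.mul_sum]
    refine Finset.sum_congr rfl fun i _ => ?_
    rw [show d + 2 - 2 * (i + 1) = d - 2 * i by omega, pow_succ]
    ring

theorem aeval_eq {d : ℕ} {f g : ℝ[X]} (h : IsGammaPoly d f g) {z : ℂ} (hz : 1 + z ≠ 0) :
    aeval z f = (1 + z) ^ d * aeval (z / (1 + z) ^ 2) g := by
  rw [aeval_eq_sum_range' (lt_of_le_of_lt h.1 (Nat.lt_succ_self _)), Finset.mul_sum]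
  conv_lhs => rw [h.2]
  rw [map_sum]
  refine Finset.sum_congr rfl fun i hi => ?_
  rw [Finset.mem_range] at hi
  simp only [map_mul, aeval_C, map_pow, map_add, map_one, aeval_X, Complex.coe_algebraMap,
    Complex.real_smul]
  obtain ⟨k, rfl⟩ : ∃ k, d = 2 * i + k := ⟨d - 2 * i, by omega⟩
  rw [show 2 * i + k - 2 * i = k by omega, div_pow, pow_add, ← pow_mul]
  field_simp

theorem coeff_nonneg {d : ℕ} {f g : ℝ[X]} (h : IsGammaPoly d f g) (hg : ∀ k, 0 ≤ g.coeff k)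
    (k : ℕ) : 0 ≤ f.coeff k := by
  rw [h.2, finsetSum_coeff]
  refine Finset.sum_nonneg fun i _ => ?_
  rw [coeff_C_mul, coeff_X_pow_mul', coeff_one_add_X_pow]
  refine mul_nonneg (hg i) ?_
  split_ifs
  · exact Nat.cast_nonneg _
  · exact le_rfl

theorem coeff_zero {d : ℕ} {f g : ℝ[X]} (h : IsGammaPoly d f g) : f.coeff 0 = g.coeff 0 := by
  rw [h.2, coeff_zero_eq_eval_zero, Finset.sum_range_succ']
  simp [eval_finsetSum]

end IsGammaPoly

theorem leadingCoeff_pos_of_coeff_nonneg {f : ℝ[X]} (h : ∀ k, 0 ≤ f.coeff k)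
    (h0 : 0 < f.coeff 0) : 0 < f.leadingCoeff := by
  refine lt_of_le_of_ne (h _) (Ne.symm ?_)
  rw [leadingCoeff_ne_zero]
  rintro rfl
  simp at h0

theorem eval_pos_of_coeff_nonneg {f : ℝ[X]} (h : ∀ k, 0 ≤ f.coeff k) (h0 : 0 < f.coeff 0)
    {r : ℝ} (hr : 0 < r) : 0 < f.eval r := by
  rw [eval_eq_sum_range, Finset.sum_range_succ', pow_zero, mul_one]
  refine add_pos_of_nonneg_of_pos (Finset.sum_nonneg fun i _ => ?_) h0
  exact mul_nonneg (h _) (pow_nonneg hr.le _)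

theorem aeval_ofReal_eq (f : ℝ[X]) (r : ℝ) : aeval (r : ℂ) f = ((f.eval r : ℝ) : ℂ) := by
  have := aeval_algebraMap_apply ℂ r f
  rw [Complex.coe_algebraMap] at this
  rw [this, coe_aeval_eq_eval]

theorem StableOrZero.aeval_ne_zero {f : ℝ[X]} (hf : StableOrZero f) (h0 : 0 < f.coeff 0) {z : ℂ}
    (hz : 0 < z.im) : aeval z f ≠ 0 := by
  rcases hf with rfl | hf
  · simp at h0
  · exact hf z hz

theorem ProperPos.interlaces {f g : ℝ[X]} (h : ProperPos f g) (hf : StableOrZero f)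
    (hg : StableOrZero g) (hf' : ∀ k, 0 ≤ f.coeff k) (hg' : ∀ k, 0 ≤ g.coeff k)
    (hf0 : 0 < f.coeff 0) (hg0 : 0 < g.coeff 0) : Interlaces f g :=
  interlaces_of_im_nonneg (leadingCoeff_pos_of_coeff_nonneg hf' hf0)
    (leadingCoeff_pos_of_coeff_nonneg hg' hg0) (fun _ hz => hf.aeval_ne_zero hf0 hz)
    (fun _ hz => hg.aeval_ne_zero hg0 hz) fun z hz => (h z hz).1

/-- For `y` in the upper half plane, the two inequalities say that `g(y)` times the conjugate of
`f(y)` lies in the cone spanned by 1 and `y`. Conjugation extends this to the lower half plane and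
positivity of the coefficients to positive reals. All three cases are needed because `x / (1 + x) ^
2` can leave the upper half plane. -/
theorem ProperPos.exists_eq_add_mul {f g : ℝ[X]} (h : ProperPos f g)
    (hf' : ∀ k, 0 ≤ f.coeff k) (hg' : ∀ k, 0 ≤ g.coeff k)
    (hf0 : 0 < f.coeff 0) (hg0 : 0 < g.coeff 0) {y : ℂ} (hy : y.im = 0 → 0 < y.re) :
    ∃ s t : ℝ, 0 ≤ s ∧ 0 ≤ t ∧ aeval y g * (starRingEnd ℂ) (aeval y f) = s + t * y := by
  have upper : ∀ y : ℂ, 0 < y.im → ∃ s t : ℝ, 0 ≤ s ∧ 0 ≤ t ∧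
      aeval y g * (starRingEnd ℂ) (aeval y f) = s + t * y := by
    intro y hy
    obtain ⟨h1, h2⟩ := h y hy
    set q := aeval y g * (starRingEnd ℂ) (aeval y f) with hq
    have e : y * aeval y f * (starRingEnd ℂ) (aeval y g) = y * (starRingEnd ℂ) q := by
      rw [hq, map_mul, Complex.conj_conj]; ring
    rw [e] at h2
    refine ⟨(y * (starRingEnd ℂ) q).im / y.im, q.im / y.im, div_nonneg h2 hy.le,
      div_nonneg h1 hy.le, Complex.ext ?_ ?_⟩
    · simp only [Complex.mul_im, Complex.conj_re, Complex.conj_im, Complex.add_re,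
        Complex.ofReal_re, Complex.mul_re, Complex.ofReal_im]
      field_simp
      ring
    · simp only [Complex.add_im, Complex.ofReal_im, Complex.mul_im, Complex.ofReal_re]
      field_simp
      ring
  rcases lt_trichotomy y.im 0 with him | him | him
  · obtain ⟨s, t, hs, ht, e⟩ := upper ((starRingEnd ℂ) y) (by simpa using him)
    refine ⟨s, t, hs, ht, ?_⟩
    rw [aeval_conj, aeval_conj] at e
    have := congrArg (starRingEnd ℂ) e
    simpa using this
  · have hre : y = ((y.re : ℝ) : ℂ) := Complex.ext (by simp) (by simp [him])
    refine ⟨g.eval y.re * f.eval y.re, 0, ?_, le_rfl, ?_⟩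
    · exact (mul_pos (eval_pos_of_coeff_nonneg hg' hg0 (hy him))
        (eval_pos_of_coeff_nonneg hf' hf0 (hy him))).le
    · rw [hre, aeval_ofReal_eq, aeval_ofReal_eq]
      simp
  · exact upper y him

theorem one_add_ne_zero_of_im_pos {x : ℂ} (hx : 0 < x.im) : 1 + x ≠ 0 := by
  intro h
  have := congrArg Complex.im h
  simp at this
  exact hx.ne' this

/-- The reciprocal is `x + 2 + 1/x`, which for `x` in the upper half plane is real only on the unit
circle, where it equals `2 + 2 re x > 0`. -/
theorem re_pos_of_im_eq_zero {x : ℂ} (hx : 0 < x.im) (h : (x / (1 + x) ^ 2).im = 0) :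
    0 < (x / (1 + x) ^ 2).re := by
  have hne := one_add_ne_zero_of_im_pos hx
  set r := (x / (1 + x) ^ 2).re with hr
  have hre : x / (1 + x) ^ 2 = (r : ℂ) := Complex.ext (by simp [hr]) (by simp [h])
  have hxe : x = r * (1 + x) ^ 2 := by rw [← hre]; field_simp
  have h1 := congrArg Complex.re hxe
  have h2 := congrArg Complex.im hxe
  rw [Complex.re_ofReal_mul] at h1
  rw [Complex.im_ofReal_mul] at h2
  simp only [pow_two, Complex.mul_re, Complex.mul_im, Complex.add_re, Complex.add_im,
    Complex.one_re, Complex.one_im, zero_add] at h1 h2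
  set a := x.re
  set b := x.im
  -- This is the imaginary part of `x = r (1 + x)²` after cancelling `b`. If `r ≤ 0` it forces `a <
  -- -1`, while the real part then gives `a ≥ (1 + a) / 2`.
  have h3 : 2 * r * (1 + a) = 1 := by
    have : b * (2 * r * (1 + a) - 1) = 0 := by linarith
    rcases mul_eq_zero.mp this with h | h <;> linarith
  by_contra hneg
  push Not at hneg
  have h4 : 1 + a < 0 := by
    by_contra h5
    push Not at h5
    nlinarith
  nlinarith [mul_nonneg (neg_nonneg.mpr hneg) (sq_nonneg b)]

theorem aeval_ne_zero_of_isGammaPoly {d : ℕ} {f γ : ℝ[X]} (h : IsGammaPoly d f γ)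
    (hγ : StableOrZero γ) (hγ' : ∀ k, 0 ≤ γ.coeff k) (hγ0 : 0 < γ.coeff 0) {x : ℂ}
    (hx : 0 < x.im) : aeval x f ≠ 0 := by
  have hne := one_add_ne_zero_of_im_pos hx
  rw [h.aeval_eq hne]
  refine mul_ne_zero (pow_ne_zero _ hne) ?_
  by_cases him : (x / (1 + x) ^ 2).im = 0
  · have hre : x / (1 + x) ^ 2 = (((x / (1 + x) ^ 2).re : ℝ) : ℂ) :=
      Complex.ext (by simp) (by rw [him]; simp)
    rw [hre, aeval_ofReal_eq]
    exact_mod_cast (eval_pos_of_coeff_nonneg hγ' hγ0 (re_pos_of_im_eq_zero hx him)).ne'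
  · exact aeval_ne_zero_of_im_ne_zero (fun z hz => hγ.aeval_ne_zero hγ0 hz) him

/-- Polynomials with centers of symmetry `d / 2` and `(d + 1) / 2` have interlacing zeros if their
`γ`-polynomials are in proper position. -/
theorem ProperPos.interlaces_of_isGammaPoly {d : ℕ} {f g γ δ : ℝ[X]} (h : ProperPos γ δ)
    (hf : IsGammaPoly d f γ) (hg : IsGammaPoly (d + 1) g δ) (hγ : StableOrZero γ)
    (hδ : StableOrZero δ) (hγ' : ∀ k, 0 ≤ γ.coeff k) (hδ' : ∀ k, 0 ≤ δ.coeff k)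
    (hγ0 : 0 < γ.coeff 0) (hδ0 : 0 < δ.coeff 0) : Interlaces f g := by
  refine interlaces_of_im_nonneg
    (leadingCoeff_pos_of_coeff_nonneg (hf.coeff_nonneg hγ') (by rwa [hf.coeff_zero]))
    (leadingCoeff_pos_of_coeff_nonneg (hg.coeff_nonneg hδ') (by rwa [hg.coeff_zero]))
    (fun x hx => aeval_ne_zero_of_isGammaPoly hf hγ hγ' hγ0 hx)
    (fun x hx => aeval_ne_zero_of_isGammaPoly hg hδ hδ' hδ0 hx) fun x hx => ?_
  have hne := one_add_ne_zero_of_im_pos hx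
  obtain ⟨s, t, hs, ht, e⟩ := h.exists_eq_add_mul hγ' hδ' hγ0 hδ0
    (y := x / (1 + x) ^ 2) (re_pos_of_im_eq_zero hx)
  -- The centers differ by one half, which leaves one extra factor `1 + x`. It turns the cone
  -- spanned by 1 and `y` into the one spanned by `1 + x` and `x / (1 + x)`, both of positive
  -- imaginary part.
  have e' : aeval x g * (starRingEnd ℂ) (aeval x f) =
      ((Complex.normSq (1 + x) ^ d : ℝ) : ℂ) * ((s : ℂ) * (1 + x) + t * (x / (1 + x))) := by
    rw [hf.aeval_eq hne, hg.aeval_eq hne, map_mul, map_pow]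
    push_cast
    rw [← Complex.mul_conj, mul_pow]
    have : (s : ℂ) * (1 + x) + t * (x / (1 + x)) = (1 + x) * (s + t * (x / (1 + x) ^ 2)) := by
      field_simp
    rw [this, ← e]
    ring
  rw [e', Complex.im_ofReal_mul]
  refine mul_nonneg (pow_nonneg (Complex.normSq_nonneg _) _) ?_
  rw [Complex.add_im, Complex.im_ofReal_mul, Complex.im_ofReal_mul]
  refine add_nonneg (mul_nonneg hs (by simpa using hx.le)) (mul_nonneg ht ?_)
  rw [Complex.div_im, ← sub_div]
  refine div_nonneg ?_ (Complex.normSq_nonneg _)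
  simp only [Complex.add_re, Complex.add_im, Complex.one_re, Complex.one_im]
  nlinarith


/-! ### Ranks of intervals -/

section IntervalRank

variable {P : Type*} [PartialOrder P] [GradeMinOrder ℕ P]

theorem intervalRank_pos {s t : P} (h : s < t) : 0 < intervalRank s t :=
  Nat.sub_pos_of_lt (grade_strictMono h)

theorem intervalRank_eq_succ {s t u : P} (h : s ⋖ t) (htu : t ≤ u) :
    intervalRank s u = intervalRank t u + 1 := by
  have h1 := Order.covBy_iff_add_one_eq.mp (h.grade ℕ)
  have h2 : grade ℕ t ≤ grade ℕ u := grade_mono htu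
  unfold intervalRank
  omega

end IntervalRank

/-! ### Recursions for the Chow polynomials -/

theorem sum_Icc_eq_add_sum_Ioc {P M : Type*} [PartialOrder P] [LocallyFiniteOrder P] [AddCommMonoid M] {s t : P} (h : s ≤ t) (f : P → M) :
    ∑ u ∈ Finset.Icc s t, f u = f s + ∑ u ∈ Finset.Ioc s t, f u := by
  classical
  rw [← Finset.Ioc_insert_left h, Finset.sum_insert Finset.left_notMem_Ioc]

section ChowRecursion

variable {P : Type*} [PartialOrder P] [LocallyFiniteOrder P] [DecidableEq P] [GradeMinOrder ℕ P]

theorem charPoly_self (s : P) : charPoly s s = 1 := by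
  simp [charPoly, intervalRank]

theorem X_sub_one_mul_redCharPoly {s t : P} (h : s < t) :
    (X - 1) * redCharPoly s t = charPoly s t := by
  have hroot : (charPoly s t).IsRoot 1 := by
    rw [IsRoot.def, charPoly, eval_finsetSum]
    simpa [h.ne] using IncidenceAlgebra.sum_Icc_mu_right (𝕜 := ℝ) s t
  have := mul_divByMonic_eq_iff_isRoot.mpr hroot
  rwa [C_1, ← C_1, ← redCharPoly, C_1] at this

theorem chow_self (s : P) : chow s s = 1 := by
  rw [chow, if_pos rfl]

theorem chow_of_ne {s t : P} (h : s ≠ t) :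
    chow s t = ∑ u ∈ Finset.Ioc s t, redCharPoly s u * chow u t := by
  rw [chow, if_neg h]
  exact Finset.sum_attach (Finset.Ioc s t) fun u => redCharPoly s u * chow u t

/-- This is the defining recursion with the denominator `x - 1` cleared. The correction term makes
it hold for `s = t` too, so that it can be convolved in the incidence algebra. -/
theorem sum_charPoly_mul_chow {s t : P} (h : s ≤ t) :
    ∑ u ∈ Finset.Icc s t, charPoly s u * chow u t =
      X * chow s t - if s = t then X - 1 else 0 := by
  rcases h.eq_or_lt with rfl | hlt
  · simp [charPoly_self, chow_self]
  · rw [sum_Icc_eq_add_sum_Ioc h, charPoly_self, one_mul, if_neg hlt.ne, sub_zero]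
    have : ∑ u ∈ Finset.Ioc s t, charPoly s u * chow u t = (X - 1) * chow s t := by
      rw [chow_of_ne hlt.ne, Finset.mul_sum]
      refine Finset.sum_congr rfl fun u hu => ?_
      rw [← X_sub_one_mul_redCharPoly (Finset.mem_Ioc.mp hu).1, mul_assoc]
    rw [this]
    ring

/-- The characteristic polynomial is the convolution of `μ` with `x ^ rank`, and the latter
convolved with `chow` is `augChow`. The claim is associativity. -/
theorem sum_mu_mul_augChow {s t : P} (h : s ≤ t) :
    ∑ v ∈ Finset.Icc s t, C (IncidenceAlgebra.mu ℝ s v) * augChow v t =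
      X * chow s t - if s = t then X - 1 else 0 := by
  rw [← sum_charPoly_mul_chow h]
  simp only [augChow, charPoly, Finset.mul_sum, Finset.sum_mul]
  rw [Finset.sum_comm' (t' := Finset.Icc s t) (s' := fun u => Finset.Icc s u)]
  · exact Finset.sum_congr rfl fun u _ => Finset.sum_congr rfl fun v _ => by ring
  · intro v u
    simp only [Finset.mem_Icc]
    exact ⟨fun h => ⟨⟨h.1.1, h.2.1⟩, h.1.1.trans h.2.1, h.2.2⟩,
      fun h => ⟨⟨h.1.1, h.1.2.trans h.2.2⟩, h.1.2, h.2.2⟩⟩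

/-- Möbius inversion of `sum_mu_mul_augChow`. -/
theorem augChow_eq_sum_chow (s t : P) :
    augChow s t = ∑ u ∈ Finset.Icc s t, (X * chow u t - if u = t then X - 1 else 0) := by
  by_cases hst : s ≤ t
  swap
  · simp [augChow, Finset.Icc_eq_empty hst]
  have h1 : ∑ u ∈ Finset.Icc s t, (X * chow u t - if u = t then X - 1 else 0) =
      ∑ u ∈ Finset.Icc s t, ∑ v ∈ Finset.Icc u t,
        C (IncidenceAlgebra.mu ℝ u v) * augChow v t :=
    Finset.sum_congr rfl fun u hu => (sum_mu_mul_augChow (Finset.mem_Icc.mp hu).2).symm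
  rw [h1, Finset.sum_comm' (t' := Finset.Icc s t) (s' := fun v => Finset.Icc s v)]
  · simp only [← Finset.sum_mul, ← map_sum, IncidenceAlgebra.sum_Icc_mu_left]
    rw [Finset.sum_eq_single s]
    · simp
    · intro v _ hv
      simp [hv.symm]
    · intro h
      exact absurd (Finset.mem_Icc.mpr ⟨le_rfl, hst⟩) h
  · intro u v
    simp only [Finset.mem_Icc]
    exact ⟨fun h => ⟨⟨h.1.1, h.2.1⟩, h.1.1.trans h.2.1, h.2.2⟩,
      fun h => ⟨⟨h.1.1, h.1.2.trans h.2.2⟩, h.1.2, h.2.2⟩⟩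

theorem one_sub_X_mul_sum_Ico {r : ℕ} (hr : 0 < r) :
    (1 - X) * ∑ i ∈ Finset.Ico 1 r, (X : ℝ[X]) ^ i = X - X ^ r := by
  induction r, hr using Nat.le_induction with
  | base => simp
  | succ r hr ih =>
    rw [Finset.sum_Ico_succ_top (by omega), mul_add, ih]
    ring

theorem augChow_eq_chow_add {s t : P} (h : s ≤ t) :
    augChow s t = chow s t + ∑ u ∈ Finset.Ioc s t, X ^ intervalRank s u * chow u t := by
  rw [augChow, sum_Icc_eq_add_sum_Ioc h]
  simp [intervalRank]

/-- The Chow polynomial as a positive sum over chains. -/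
theorem chow_eq_one_add_sum {s t : P} (h : s ≤ t) :
    chow s t = 1 + ∑ u ∈ Finset.Ioc s t,
      (∑ i ∈ Finset.Ico 1 (intervalRank s u), X ^ i) * chow u t := by
  have h1 := augChow_eq_sum_chow s t
  rw [augChow_eq_chow_add h, Finset.sum_sub_distrib, Finset.sum_ite_eq' (Finset.Icc s t) t,
    if_pos (Finset.mem_Icc.mpr ⟨h, le_rfl⟩), sum_Icc_eq_add_sum_Ioc h] at h1
  have hne : (1 - X : ℝ[X]) ≠ 0 := by
    intro h0
    have := congrArg (Polynomial.eval 0) h0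
    simp at this
  -- Equating the two expressions for `augChow` determines `(1 - X)` times the Chow polynomial; the
  -- geometric sums arise from `(X - X ^ r) / (1 - X)`.
  refine mul_left_cancel₀ hne ?_
  rw [mul_add, Finset.mul_sum]
  have h2 : ∑ u ∈ Finset.Ioc s t, (1 - X) *
      ((∑ i ∈ Finset.Ico 1 (intervalRank s u), X ^ i) * chow u t) =
      ∑ u ∈ Finset.Ioc s t, X * chow u t -
        ∑ u ∈ Finset.Ioc s t, X ^ intervalRank s u * chow u t := by
    rw [← Finset.sum_sub_distrib]
    refine Finset.sum_congr rfl fun u hu => ?_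
    rw [← mul_assoc, one_sub_X_mul_sum_Ico (intervalRank_pos (Finset.mem_Ioc.mp hu).1), sub_mul]
  rw [h2]
  linear_combination h1

theorem coeff_zero_sum_Ico_mul (r : ℕ) (f : ℝ[X]) :
    ((∑ i ∈ Finset.Ico 1 r, X ^ i) * f).coeff 0 = 0 := by
  rw [mul_coeff_zero, finsetSum_coeff, Finset.sum_eq_zero, zero_mul]
  intro i hi
  rw [Finset.mem_Ico] at hi
  simp [coeff_X_pow]
  omega

theorem chow_coeff_zero {s t : P} (h : s ≤ t) : (chow s t).coeff 0 = 1 := by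
  rw [chow_eq_one_add_sum h, coeff_add, finsetSum_coeff,
    Finset.sum_eq_zero fun u _ => coeff_zero_sum_Ico_mul _ _]
  simp

theorem augChow_coeff_zero {s t : P} (h : s ≤ t) : (augChow s t).coeff 0 = 1 := by
  rw [augChow_eq_chow_add h, coeff_add, chow_coeff_zero h, finsetSum_coeff, Finset.sum_eq_zero,
    add_zero]
  intro u hu
  have := intervalRank_pos (Finset.mem_Ioc.mp hu).1
  rw [mul_coeff_zero, coeff_X_pow, if_neg this.ne, zero_mul]

end ChowRecursion


/-! ### Rising chains -/

section Rising

variable {P Λ : Type*} [PartialOrder P] [LinearOrder Λ]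

/-- There is a saturated chain from `s` to `u` with weakly increasing labels, whose first step is
`s ⋖ t`. -/
inductive RisesVia (lam : P → P → Λ) : P → P → P → Prop
  | base {s t : P} : s ⋖ t → RisesVia lam s t t
  | step {s t t' u : P} : s ⋖ t → lam s t ≤ lam t t' → RisesVia lam t t' u → RisesVia lam s t u

variable {lam : P → P → Λ}

theorem RisesVia.covBy {s t u : P} (h : RisesVia lam s t u) : s ⋖ t := by
  cases h <;> assumption

theorem RisesVia.le {s t u : P} (h : RisesVia lam s t u) : t ≤ u := by
  induction h with
  | base _ => exact le_rfl
  | step _ _ h ih => exact h.covBy.le.trans ih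

theorem RisesVia.exists_chain {s t u : P} (h : RisesVia lam s t u) :
    ∃ r : List P, IsSaturatedChain s u (s :: t :: r) ∧
      (labelSeq lam (s :: t :: r)).Pairwise (· ≤ ·) := by
  induction h with
  | base h => exact ⟨[], ⟨by simpa using h, by simp, by simp⟩, by simp [labelSeq]⟩
  | @step s t t' u h hle _ ih =>
    obtain ⟨r, ⟨h1, _, h3⟩, h4⟩ := ih
    refine ⟨t' :: r, ⟨List.isChain_cons_cons.mpr ⟨h, h1⟩, rfl, ?_⟩, ?_⟩
    · rw [List.getLast?_cons_cons]; exact h3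
    · change (lam s t :: lam t t' :: labelSeq lam (t' :: r)).Pairwise (· ≤ ·)
      rw [← List.isChain_iff_pairwise] at h4 ⊢
      exact List.isChain_cons_cons.mpr ⟨hle, h4⟩

theorem RisesVia.of_chain {u : P} (r : List P) : ∀ s t : P, IsSaturatedChain s u (s :: t :: r) →
    (labelSeq lam (s :: t :: r)).Pairwise (· ≤ ·) → RisesVia lam s t u := by
  induction r with
  | nil =>
    intro s t h _
    obtain ⟨h1, _, h3⟩ := h
    obtain rfl : t = u := by simpa using h3
    exact .base (by simpa using h1)
  | cons t' r ih =>
    intro s t h hp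
    obtain ⟨h1, _, h3⟩ := h
    rw [List.isChain_cons_cons] at h1
    rw [List.getLast?_cons_cons] at h3
    change (lam s t :: lam t t' :: labelSeq lam (t' :: r)).Pairwise (· ≤ ·) at hp
    rw [List.pairwise_cons] at hp
    exact .step h1.1 (hp.1 _ (by simp)) (ih t t' ⟨h1.2, rfl, h3⟩ hp.2)

theorem IsELLabeling.existsUnique_risesVia (hlam : IsELLabeling lam) {s u : P} (h : s < u) :
    ∃! t, RisesVia lam s t u := by
  obtain ⟨c, hc, hp, huniq, _⟩ := hlam s u h.le
  have hex : ∃ t r, c = s :: t :: r := by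
    obtain ⟨_, h2, h3⟩ := hc
    rcases c with _ | ⟨a, _ | ⟨t, r⟩⟩
    · simp at h2
    · simp only [List.head?_cons, List.getLast?_singleton, Option.some.injEq] at h2 h3
      exact absurd (h2.symm.trans h3) h.ne
    · simp only [List.head?_cons, Option.some.injEq] at h2
      exact ⟨t, r, by rw [h2]⟩
  obtain ⟨t, r, rfl⟩ := hex
  refine ⟨t, RisesVia.of_chain r s t hc hp, fun t' ht' => ?_⟩
  obtain ⟨r', h1, h2⟩ := ht'.exists_chain
  have := huniq _ h1 h2
  simp only [List.cons.injEq, true_and] at this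
  exact this.1

theorem risesVia_iff {s t u : P} (h : s ⋖ t) :
    RisesVia lam s t u ↔ u = t ∨ ∃ t', t ⋖ t' ∧ lam s t ≤ lam t t' ∧ RisesVia lam t t' u := by
  constructor
  · intro hr
    cases hr with
    | base _ => exact Or.inl rfl
    | step _ h2 h3 => exact Or.inr ⟨_, h3.covBy, h2, h3⟩
  · rintro (rfl | ⟨t', _, h2, h3⟩)
    · exact .base h
    · exact .step h h2 h3

end Rising

-- Splitting the Chow polynomials by the first step of rising chains

section EdgePolynomials

variable {P Λ : Type*} [PartialOrder P] [LinearOrder Λ] [LocallyFiniteOrder P] [OrderTop P]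

open Classical in
/-- The elements covering `s`. -/
def coversAbove (s : P) : Finset P := (Finset.Ioc s ⊤).filter (s ⋖ ·)

theorem mem_coversAbove {s t : P} : t ∈ coversAbove s ↔ s ⋖ t := by
  simp only [coversAbove, Finset.mem_filter, Finset.mem_Ioc, le_top, and_true]
  exact ⟨fun h => h.2, fun h => ⟨h.lt, h⟩⟩

open Classical in
/-- The elements to which the rising chain from `s` starts with the step `s ⋖ t`. -/
def risingSet (lam : P → P → Λ) (s t : P) : Finset P :=
  (Finset.Icc t ⊤).filter (RisesVia lam s t ·)

variable {lam : P → P → Λ}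

theorem mem_risingSet {s t u : P} : u ∈ risingSet lam s t ↔ RisesVia lam s t u := by
  simp only [risingSet, Finset.mem_filter, Finset.mem_Icc, le_top, and_true]
  exact ⟨fun h => h.2, fun h => ⟨h.le, h⟩⟩

theorem sum_Ioc_eq_sum_risingSet (hlam : IsELLabeling lam) {M : Type*} [AddCommMonoid M] (s : P)
    (f : P → M) :
    ∑ u ∈ Finset.Ioc s ⊤, f u = ∑ t ∈ coversAbove s, ∑ u ∈ risingSet lam s t, f u := by
  classical
  rw [← Finset.sum_biUnion]
  · refine Finset.sum_congr ?_ fun _ _ => rfl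
    ext u
    simp only [Finset.mem_Ioc, le_top, and_true, Finset.mem_biUnion, mem_coversAbove, mem_risingSet]
    constructor
    · intro h
      obtain ⟨t, ht, _⟩ := hlam.existsUnique_risesVia h
      exact ⟨t, ht.covBy, ht⟩
    · rintro ⟨t, h, ht⟩
      exact h.lt.trans_le ht.le
  · intro t _ t' _ hne
    rw [Function.onFun, Finset.disjoint_left]
    intro u hu hu'
    rw [mem_risingSet] at hu hu'
    exact hne ((hlam.existsUnique_risesVia (hu.covBy.lt.trans_le hu.le)).unique hu hu')

/-- A rising chain through `s ⋖ t` stops at `t` or continues with a non-descent. Uniqueness of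
rising chains makes the continuations disjoint. -/
theorem sum_risingSet (hlam : IsELLabeling lam) {M : Type*} [AddCommMonoid M] {s t : P}
    (h : s ⋖ t) (f : P → M) :
    ∑ u ∈ risingSet lam s t, f u = f t +
      ∑ t' ∈ (coversAbove t).filter (fun t' => ¬ lam t t' < lam s t),
        ∑ u ∈ risingSet lam t t', f u := by
  classical
  rw [← Finset.sum_biUnion, ← Finset.sum_insert]
  · refine Finset.sum_congr ?_ fun _ _ => rfl
    ext u
    simp only [Finset.mem_insert, Finset.mem_biUnion, Finset.mem_filter, mem_coversAbove,
      mem_risingSet, not_lt, risesVia_iff h, and_assoc]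
  · simp only [Finset.mem_biUnion, Finset.mem_filter, mem_coversAbove, mem_risingSet, not_exists,
      not_and]
    intro t' ht' hr
    exact absurd hr.le (not_le_of_gt ht'.1.lt)
  · intro t₁ _ t₂ _ hne
    rw [Function.onFun, Finset.disjoint_left]
    intro u hu hu'
    rw [mem_risingSet] at hu hu'
    exact hne ((hlam.existsUnique_risesVia (hu.covBy.lt.trans_le hu.le)).unique hu hu')

theorem risingSet_top {s : P} (h : s ⋖ ⊤) : risingSet lam s ⊤ = {⊤} := by
  ext u
  rw [mem_risingSet, Finset.mem_singleton]
  exact ⟨fun h => top_le_iff.mp h.le, by rintro rfl; exact .base h⟩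

variable [DecidableEq P] [GradeMinOrder ℕ P]

variable (lam) in
/-- The contribution of `s ⋖ t` to the Chow polynomial of `[s, ⊤]`: in the expansion of the latter
over chains, the next element is restricted to those to which the rising chain from `s` starts with
`s ⋖ t`. -/
def edgeChow (s t : P) : ℝ[X] :=
  ∑ u ∈ risingSet lam s t, ((if u = ⊤ then 1 else 0) +
    (∑ i ∈ Finset.Ico 1 (intervalRank s u), X ^ i) * chow u ⊤)

variable (lam) in
/-- The contribution of `s ⋖ t` to the augmented Chow polynomial of `[s, ⊤]`. -/
def edgeAugChow (s t : P) : ℝ[X] :=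
  ∑ u ∈ risingSet lam s t, ((if u = ⊤ then 1 else 0) +
    (∑ i ∈ Finset.Ico 1 (intervalRank s u + 1), X ^ i) * chow u ⊤)

theorem chow_eq_sum_edgeChow (hlam : IsELLabeling lam) {s : P} (hs : s ≠ ⊤) :
    chow s ⊤ = ∑ t ∈ coversAbove s, edgeChow lam s t := by
  rw [chow_eq_one_add_sum le_top]
  simp only [edgeChow]
  rw [← sum_Ioc_eq_sum_risingSet hlam, Finset.sum_add_distrib, Finset.sum_ite_eq',
    if_pos (Finset.mem_Ioc.mpr ⟨hs.lt_top, le_rfl⟩)]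

theorem edgeAugChow_eq_add {s t : P} (h : s ⋖ t) :
    edgeAugChow lam s t =
      edgeChow lam s t + ∑ u ∈ risingSet lam s t, X ^ intervalRank s u * chow u ⊤ := by
  rw [edgeChow, edgeAugChow, ← Finset.sum_add_distrib]
  refine Finset.sum_congr rfl fun u hu => ?_
  rw [mem_risingSet] at hu
  rw [Finset.sum_Ico_succ_top (intervalRank_pos (h.lt.trans_le hu.le))]
  ring

theorem augChow_eq_sum_edgeAugChow (hlam : IsELLabeling lam) {s : P} (hs : s ≠ ⊤) :
    augChow s ⊤ = ∑ t ∈ coversAbove s, edgeAugChow lam s t := by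
  rw [augChow_eq_chow_add le_top, chow_eq_sum_edgeChow hlam hs, sum_Ioc_eq_sum_risingSet hlam,
    ← Finset.sum_add_distrib]
  exact Finset.sum_congr rfl fun t ht => (edgeAugChow_eq_add (mem_coversAbove.mp ht)).symm

/-- The term `u = t` has rank 1 and an empty geometric sum. For other `u` the rank from `s` exceeds
that from `t` by one, which is exactly the longer geometric sum of the augmented contribution. -/
theorem edgeChow_eq_sum_edgeAugChow (hlam : IsELLabeling lam) {s t : P} (h : s ⋖ t)
    (ht : t ≠ ⊤) :
    edgeChow lam s t =
      ∑ t' ∈ (coversAbove t).filter (fun t' => ¬ lam t t' < lam s t), edgeAugChow lam t t' := by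
  have hr : intervalRank s t = 1 := by
    rw [intervalRank_eq_succ h le_rfl]; simp [intervalRank]
  rw [edgeChow, sum_risingSet hlam h, if_neg ht, hr]
  simp only [Finset.Ico_self, Finset.sum_empty, zero_mul, add_zero, zero_add]
  refine Finset.sum_congr rfl fun t' ht' => Finset.sum_congr rfl fun u hu => ?_
  rw [mem_risingSet] at hu
  rw [intervalRank_eq_succ h (hu.covBy.le.trans hu.le)]

/-- The excess over `edgeChow lam s t` is `X * chow t ⊤` plus `X` times the differences of augmented
and plain contributions over non-descents. Expanding `chow t ⊤` over all covers cancels the plain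
non-descent terms and leaves those of the descents. -/
theorem edgeAugChow_eq (hlam : IsELLabeling lam) {s t : P} (h : s ⋖ t) (ht : t ≠ ⊤) :
    edgeAugChow lam s t = (1 + X) * edgeChow lam s t +
      X * ∑ t' ∈ (coversAbove t).filter (fun t' => lam t t' < lam s t), edgeChow lam t t' := by
  have hr : intervalRank s t = 1 := by
    rw [intervalRank_eq_succ h le_rfl]; simp [intervalRank]
  have h1 : ∑ u ∈ risingSet lam s t, X ^ intervalRank s u * chow u ⊤ = X * chow t ⊤ +
      X * ∑ t' ∈ (coversAbove t).filter (fun t' => ¬ lam t t' < lam s t),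
        (edgeAugChow lam t t' - edgeChow lam t t') := by
    rw [sum_risingSet hlam h, hr, pow_one, Finset.mul_sum]
    congr 1
    refine Finset.sum_congr rfl fun t' ht' => ?_
    rw [edgeAugChow_eq_add (mem_coversAbove.mp (Finset.mem_filter.mp ht').1), add_sub_cancel_left,
      Finset.mul_sum]
    refine Finset.sum_congr rfl fun u hu => ?_
    rw [mem_risingSet] at hu
    rw [intervalRank_eq_succ h (hu.covBy.le.trans hu.le), pow_succ]
    ring
  rw [edgeAugChow_eq_add h, h1, Finset.sum_sub_distrib, ← edgeChow_eq_sum_edgeAugChow hlam h ht,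
    chow_eq_sum_edgeChow hlam ht,
    ← Finset.sum_filter_add_sum_filter_not (coversAbove t) (fun t' => lam t t' < lam s t)]
  ring

theorem edgeChow_top {s : P} (h : s ⋖ ⊤) : edgeChow lam s ⊤ = 1 := by
  have hr : intervalRank s ⊤ = 1 := by
    rw [intervalRank_eq_succ h le_rfl]; simp [intervalRank]
  simp [edgeChow, risingSet_top h, hr]

theorem edgeAugChow_top {s : P} (h : s ⋖ ⊤) : edgeAugChow lam s ⊤ = 1 + X := by
  have hr : intervalRank s ⊤ = 1 := by
    rw [intervalRank_eq_succ h le_rfl]; simp [intervalRank]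
  simp [edgeAugChow, risingSet_top h, hr, chow_self]

end EdgePolynomials


/-! ### Rank-uniform label data -/

theorem finite_labelsAbove {P Λ : Type*} [PartialOrder P] [Finite P] (lam : P → P → Λ)
    (s : P) : (labelsAbove lam s).Finite :=
  (Set.finite_range (lam s)).subset fun _ ⟨t, _, h⟩ => ⟨t, h⟩

section LabelIndex

variable {P Λ : Type*} [PartialOrder P] [Finite P] [LinearOrder Λ] (lam : P → P → Λ)

/-- The labels above `t` smaller than that of `s ⋖ t` form an initial segment, so descents are
recognized by index alone. -/
theorem labelIndex_le_labelDes_iff {s t t' : P} (h : t ⋖ t') :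
    labelIndex lam t t' ≤ labelDes lam s t ↔ lam t t' < lam s t := by
  have hfin := finite_labelsAbove lam t
  constructor
  · intro hle
    by_contra hlt
    push Not at hlt
    refine absurd hle (not_le.mpr ?_)
    refine Set.ncard_lt_ncard ?_ (hfin.subset (Set.sep_subset _ _))
    refine (Set.ssubset_iff_of_subset ?_).mpr
      ⟨lam t t', ⟨⟨t', h, rfl⟩, le_rfl⟩, fun hx => absurd hx.2 (not_lt.mpr hlt)⟩
    exact fun x hx => ⟨hx.1, hx.2.le.trans hlt⟩
  · intro hlt
    exact Set.ncard_le_ncard (fun x hx => ⟨hx.1, hx.2.trans_lt hlt⟩)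
      (hfin.subset (Set.sep_subset _ _))

theorem labelIndex_pos {s t : P} (h : s ⋖ t) : 0 < labelIndex lam s t := by
  refine (Set.ncard_pos ((finite_labelsAbove lam s).subset (Set.sep_subset _ _))).mpr ?_
  exact ⟨lam s t, ⟨t, h, rfl⟩, le_rfl⟩

theorem labelIndex_le_card (s t : P) : labelIndex lam s t ≤ Nat.card P := by
  calc labelIndex lam s t ≤ (Set.range (lam s)).ncard :=
        Set.ncard_le_ncard (fun x ⟨⟨t, _, h⟩, _⟩ => ⟨t, h⟩) (Set.finite_range _)
    _ ≤ Nat.card P := by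
        rw [← Set.image_univ, ← Set.ncard_univ]
        exact Set.ncard_image_le Set.finite_univ

theorem labelWidth_zero (s : P) : labelWidth lam s 0 = 0 := by
  rw [labelWidth, Set.ncard_eq_zero]
  ext t
  simp only [Set.mem_ofPred_eq, Set.mem_empty_iff_false, iff_false, not_and]
  exact fun h => (labelIndex_pos lam h).ne'

end LabelIndex

section Corank

variable {P : Type*} [PartialOrder P] [OrderTop P] [GradeMinOrder ℕ P]

theorem grade_eq_of_intervalRank_eq {s s' : P} (h : intervalRank s ⊤ = intervalRank s' ⊤) :
    grade ℕ s = grade ℕ s' := by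
  have h1 : grade ℕ s ≤ grade ℕ (⊤ : P) := grade_mono le_top
  have h2 : grade ℕ s' ≤ grade ℕ (⊤ : P) := grade_mono le_top
  unfold intervalRank at h
  omega

theorem eq_top_of_intervalRank_eq_zero {s : P} (h : intervalRank s ⊤ = 0) : s = ⊤ := by
  by_contra hs
  exact (intervalRank_pos (lt_top_iff_ne_top.mpr hs)).ne' h

end Corank

theorem card_filter_labelIndex_eq {P Λ : Type*} [PartialOrder P] [LinearOrder Λ]
    [LocallyFiniteOrder P] [OrderTop P] {lam : P → P → Λ} (s : P) (j : ℕ) :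
    ((coversAbove s).filter (fun t => labelIndex lam s t = j)).card = labelWidth lam s j := by
  rw [labelWidth, ← Set.ncard_coe_finset]
  congr 1
  ext t
  simp [mem_coversAbove]

section UniformData

variable {P Λ : Type*} [PartialOrder P] [Finite P] [LinearOrder Λ] [OrderTop P]
  [GradeMinOrder ℕ P] (lam : P → P → Λ)

open Classical in
/-- The widths above the elements of corank `m + 1`. -/
def corankWidth (m j : ℕ) : ℕ :=
  if h : ∃ s : P, intervalRank s ⊤ = m + 1 then labelWidth lam h.choose j else 0

/-- The largest descent count of a covering relation `s ⋖ t` with `t` of corank `m` whose label has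
index at most `i`. -/
def corankDes (m i : ℕ) : ℕ :=
  (Set.toFinite {e : P × P | e.1 ⋖ e.2 ∧ intervalRank e.2 ⊤ = m ∧
    labelIndex lam e.1 e.2 ≤ i}).toFinset.sup fun e => labelDes lam e.1 e.2

/-- Taking a running maximum makes this true at all natural numbers, including indices that no cover
realizes. -/
theorem corankDes_mono (m : ℕ) : Monotone (corankDes lam m) := by
  intro i j hij
  refine Finset.sup_mono fun e he => ?_
  rw [Set.Finite.mem_toFinset] at he ⊢
  exact ⟨he.1, he.2.1, he.2.2.trans hij⟩

theorem corankWidth_zero (m : ℕ) : corankWidth lam m 0 = 0 := by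
  rw [corankWidth]
  split_ifs
  · exact labelWidth_zero lam _
  · rfl

variable {lam}

theorem IsUMELLabeling.corankWidth_eq (hlam : IsUMELLabeling lam) {s : P} {m : ℕ}
    (hs : intervalRank s ⊤ = m + 1) (j : ℕ) : corankWidth lam m j = labelWidth lam s j := by
  have hex : ∃ s : P, intervalRank s ⊤ = m + 1 := ⟨s, hs⟩
  rw [corankWidth, dif_pos hex]
  rcases Nat.eq_zero_or_pos j with rfl | hj
  · rw [labelWidth_zero, labelWidth_zero]
  · exact hlam.uniform_width _ _ (grade_eq_of_intervalRank_eq (hex.choose_spec.trans hs.symm)) j hj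

theorem IsUMELLabeling.corankDes_eq (hlam : IsUMELLabeling lam) {s t : P} (h : s ⋖ t) {m : ℕ}
    (ht : intervalRank t ⊤ = m) : corankDes lam m (labelIndex lam s t) = labelDes lam s t := by
  refine le_antisymm (Finset.sup_le fun e he => ?_) ?_
  · rw [Set.Finite.mem_toFinset] at he
    obtain ⟨h1, h2, h3⟩ := he
    refine hlam.monotonic _ _ _ _ (grade_eq_of_intervalRank_eq ?_) h1 h h3
    rw [intervalRank_eq_succ h1 le_top, intervalRank_eq_succ h le_top, h2, ht]
  · exact Finset.le_sup (f := fun e : P × P => labelDes lam e.1 e.2) (b := (s, t))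
      ((Set.Finite.mem_toFinset _).mpr ⟨h, ht, le_rfl⟩)

variable [LocallyFiniteOrder P]

theorem IsUMELLabeling.sum_coversAbove (hlam : IsUMELLabeling lam) {s : P} {m : ℕ}
    (hs : intervalRank s ⊤ = m + 1) (p : ℕ → Prop) [DecidablePred p] (f : ℕ → ℝ[X]) :
    ∑ t ∈ (coversAbove s).filter (fun t => p (labelIndex lam s t)), f (labelIndex lam s t) =
      ∑ j ∈ (Finset.range (Nat.card P + 1)).filter p, C (corankWidth lam m j : ℝ) * f j := by
  rw [Finset.sum_filter, Finset.sum_filter,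
    ← Finset.sum_fiberwise_of_maps_to (t := Finset.range (Nat.card P + 1))
      (g := labelIndex lam s) fun t _ =>
      Finset.mem_range.mpr (Nat.lt_succ_of_le (labelIndex_le_card lam s t))]
  refine Finset.sum_congr rfl fun j _ => ?_
  rw [Finset.sum_congr rfl (g := fun _ => if p j then f j else 0) fun t ht => by
    rw [(Finset.mem_filter.mp ht).2], Finset.sum_const, card_filter_labelIndex_eq,
    hlam.corankWidth_eq hs, nsmul_eq_mul]
  split_ifs <;> simp

variable [DecidableEq P]

/-- The weight polynomials of the steps of an UMEL-labeled poset are the `γ`-polynomials of the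
contributions of the covering relations. -/
theorem IsUMELLabeling.isGammaPoly_edge (hlam : IsUMELLabeling lam) (m : ℕ) :
    ∀ s t : P, s ⋖ t → intervalRank t ⊤ = m →
      IsGammaPoly m (edgeChow lam s t) (noFirstDescentPoly (Nat.card P + 1) (corankWidth lam)
        (corankDes lam) m (labelIndex lam s t)) ∧
      IsGammaPoly (m + 1) (edgeAugChow lam s t) (isolatedDescentPoly (Nat.card P + 1)
        (corankWidth lam) (corankDes lam) m (labelIndex lam s t)) := by
  induction m with
  | zero =>
    intro s t h ht
    obtain rfl := eq_top_of_intervalRank_eq_zero ht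
    rw [edgeChow_top h, edgeAugChow_top h, noFirstDescentPoly_zero, isolatedDescentPoly_zero]
    refine ⟨.one, ?_⟩
    simpa using IsGammaPoly.one.one_add_X_mul
  | succ m ih =>
    intro s t h ht
    have htop : t ≠ ⊤ := by
      rintro rfl
      simp [intervalRank] at ht
    have hiff : ∀ t' ∈ coversAbove t,
        (lam t t' < lam s t ↔ labelIndex lam t t' ≤
          corankDes lam (m + 1) (labelIndex lam s t)) := by
      intro t' ht'
      rw [hlam.corankDes_eq h ht, labelIndex_le_labelDes_iff lam (mem_coversAbove.mp ht')]
    have hrank : ∀ t' ∈ coversAbove t, intervalRank t' ⊤ = m := by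
      intro t' ht'
      have := intervalRank_eq_succ (mem_coversAbove.mp ht') (le_top (a := t'))
      omega
    have hG : IsGammaPoly (m + 1) (edgeChow lam s t) (noFirstDescentPoly (Nat.card P + 1)
        (corankWidth lam) (corankDes lam) (m + 1) (labelIndex lam s t)) := by
      rw [edgeChow_eq_sum_edgeAugChow hlam.el h htop, noFirstDescentPoly_succ, upperSum,
        ← hlam.sum_coversAbove ht,
        Finset.filter_congr (q := fun t' => ¬ labelIndex lam t t' ≤
          corankDes lam (m + 1) (labelIndex lam s t)) fun t' ht' => not_congr (hiff t' ht')]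
      refine IsGammaPoly.sum _ fun t' ht' => ?_
      have ht'' := (Finset.mem_filter.mp ht').1
      exact (ih t t' (mem_coversAbove.mp ht'') (hrank t' ht'')).2
    refine ⟨hG, ?_⟩
    rw [edgeAugChow_eq hlam.el h htop, isolatedDescentPoly_succ]
    refine IsGammaPoly.add ?_ (IsGammaPoly.X_mul ?_)
    -- Multiplication by `1 + X` only shifts the center, so the γ-polynomial is the one already
    -- found for `edgeChow`.
    · rw [← noFirstDescentPoly_succ]
      exact hG.one_add_X_mul
    · rw [lowerSum, ← hlam.sum_coversAbove ht,
        Finset.filter_congr (q := fun t' => labelIndex lam t t' ≤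
          corankDes lam (m + 1) (labelIndex lam s t)) hiff]
      refine IsGammaPoly.sum _ fun t' ht' => ?_
      have ht'' := (Finset.mem_filter.mp ht').1
      exact (ih t t' (mem_coversAbove.mp ht'') (hrank t' ht'')).1

theorem IsUMELLabeling.isGammaPoly_chow (hlam : IsUMELLabeling lam) (s : P) :
    IsGammaPoly (intervalRank s ⊤ - 1) (chow s ⊤) (totalNoFirstDescentPoly (Nat.card P + 1)
        (corankWidth lam) (corankDes lam) (intervalRank s ⊤)) ∧
      IsGammaPoly (intervalRank s ⊤) (augChow s ⊤) (totalPoly (Nat.card P + 1)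
        (corankWidth lam) (corankDes lam) (intervalRank s ⊤)) := by
  rcases hm : intervalRank s ⊤ with _ | m
  · obtain rfl := eq_top_of_intervalRank_eq_zero hm
    have h1 : augChow (⊤ : P) ⊤ = 1 := by simp [augChow, intervalRank, chow_self]
    rw [chow_self, h1, totalNoFirstDescentPoly, totalPoly]
    exact ⟨.one, .one⟩
  · have hs : s ≠ ⊤ := by
      rintro rfl
      simp [intervalRank] at hm
    have hrank : ∀ t ∈ coversAbove s, intervalRank t ⊤ = m := by
      intro t ht
      have := intervalRank_eq_succ (mem_coversAbove.mp ht) (le_top (a := t))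
      omega
    rw [chow_eq_sum_edgeChow hlam.el hs, augChow_eq_sum_edgeAugChow hlam.el hs,
      totalNoFirstDescentPoly, totalPoly, Nat.add_sub_cancel]
    have hsum := fun f => hlam.sum_coversAbove hm (fun _ => True) f
    simp only [Finset.filter_true] at hsum
    rw [← hsum, ← hsum]
    exact ⟨IsGammaPoly.sum _ fun t ht =>
        (hlam.isGammaPoly_edge m s t (mem_coversAbove.mp ht) (hrank t ht)).1,
      IsGammaPoly.sum _ fun t ht =>
        (hlam.isGammaPoly_edge m s t (mem_coversAbove.mp ht) (hrank t ht)).2⟩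

end UniformData

/-! ### Atomistic posets -/

theorem isSaturatedChain_triple {P : Type*} [PartialOrder P] {s t u : P} (h : s ⋖ t) (h' : t ⋖ u) :
    IsSaturatedChain s u [s, t, u] := by
  refine ⟨by simp [h, h'], by simp, by simp⟩

theorem grade_atom {P : Type*} [PartialOrder P] [GradeMinOrder ℕ P] [OrderBot P]
    {a : P} (ha : IsAtom a) : grade ℕ a = grade ℕ (⊥ : P) + 1 :=
  (Order.covBy_iff_add_one_eq.mp (ha.bot_covBy.grade ℕ)).symm

section Atomistic

variable {P Λ : Type*} [PartialOrder P] [Finite P] [LinearOrder Λ] [GradeMinOrder ℕ P]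
  {lam : P → P → Λ}

/-- The number of labels is the largest index of nonzero width, and the widths are rank-uniform. -/
theorem ncard_labelsAbove_eq (hlam : IsUMELLabeling lam) {s s' : P}
    (h : grade ℕ s = grade ℕ s') : (labelsAbove lam s).ncard = (labelsAbove lam s').ncard := by
  have key : ∀ {s s' : P}, grade ℕ s = grade ℕ s' →
      (labelsAbove lam s).ncard ≤ (labelsAbove lam s').ncard := by
    intro s s' h
    have hfin := finite_labelsAbove lam s
    rcases (labelsAbove lam s).eq_empty_or_nonempty with he | hne
    · simp [he]
    obtain ⟨x, hx, hmax⟩ := Set.exists_max_image _ id hfin hne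
    obtain ⟨t, ht, rfl⟩ := hx
    have hidx : labelIndex lam s t = (labelsAbove lam s).ncard := by
      rw [labelIndex]
      congr 1
      ext y
      exact ⟨fun hy => hy.1, fun hy => ⟨hy, hmax y hy⟩⟩
    have hw := hlam.uniform_width s s' h _ (labelIndex_pos lam ht)
    have hpos : 0 < labelWidth lam s (labelIndex lam s t) :=
      (Set.ncard_pos (Set.toFinite _)).mpr ⟨t, ht, rfl⟩
    rw [hw, labelWidth, Set.ncard_pos (Set.toFinite _)] at hpos
    obtain ⟨t', _, h2⟩ := hpos
    rw [← hidx, ← h2]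
    exact Set.ncard_le_ncard (Set.sep_subset _ _) (finite_labelsAbove lam s')
  exact le_antisymm (key h) (key h.symm)

variable [BoundedOrder P]

/-- If `⊥ ⋖ b ⋖ t` were rising with the largest first label, then `t`, being a join of atoms, would
cover another atom `b'`. Lexicographic minimality forces the label of `b'` to equal that of `b`. The
chain through `b'` is not rising, so its second label is smaller, which makes it lexicographically
smaller. -/
theorem IsUMELLabeling.lastLabelAllDescents [IsAtomistic P] (hlam : IsUMELLabeling lam) :
    LastLabelAllDescents lam := by
  intro a b ha hb hidx
  have hfin := finite_labelsAbove lam (⊥ : P)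
  have hmax : ∀ x ∈ labelsAbove lam (⊥ : P), x ≤ lam ⊥ b := by
    have := Set.eq_of_subset_of_ncard_le (Set.sep_subset (labelsAbove lam (⊥ : P))
      (fun x => x ≤ lam ⊥ b)) hidx.ge hfin
    intro x hx
    rw [← this] at hx
    exact hx.2
  rw [ncard_labelsAbove_eq hlam ((grade_atom ha).trans (grade_atom hb).symm), labelDes]
  congr 1
  ext x
  refine ⟨fun hx => hx.1, fun hx => ⟨hx, ?_⟩⟩
  obtain ⟨t, hbt, rfl⟩ := hx
  by_contra hle
  push Not at hle
  obtain ⟨S, hS, hatoms⟩ := IsAtomistic.isLUB_atoms t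
  obtain ⟨b', hb'S, hne⟩ : ∃ b' ∈ S, b' ≠ b := by
    by_contra hall
    push Not at hall
    exact absurd (hS.2 fun x hx => (hall x hx).le) (not_le_of_gt hbt.lt)
  have hb' := hatoms b' hb'S
  have hb't : b' ⋖ t := by
    have hle' : b' ≤ t := hS.1 hb'S
    have hg : grade ℕ b' + 1 = grade ℕ t := by
      rw [grade_atom hb', ← grade_atom hb]
      exact Order.covBy_iff_add_one_eq.mp (hbt.grade ℕ)
    have hlt : b' < t := lt_of_le_of_ne hle' (by rintro rfl; omega)
    refine ⟨hlt, fun c hc hc' => ?_⟩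
    have h1 : grade ℕ b' < grade ℕ c := grade_strictMono hc
    have h2 : grade ℕ c < grade ℕ t := grade_strictMono hc'
    omega
  obtain ⟨c, hc, hrise, huniq, hlex⟩ := hlam.el ⊥ t bot_le
  have hcb := huniq _ (isSaturatedChain_triple hb.bot_covBy hbt)
    (by simpa [labelSeq] using hle)
  subst hcb
  have hnot := hlex _ (isSaturatedChain_triple hb'.bot_covBy hb't)
  simp only [labelSeq, List.tail_cons, List.zipWith_cons_cons, List.zipWith_nil_right] at hnot
  have hle1 : lam ⊥ b' ≤ lam ⊥ b := hmax _ ⟨b', hb'.bot_covBy, rfl⟩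
  have heq : lam ⊥ b' = lam ⊥ b := by
    refine hle1.eq_of_not_lt fun hlt => hnot (.rel hlt)
  have hdesc : lam b' t < lam ⊥ b' := by
    by_contra hge
    push Not at hge
    have := huniq _ (isSaturatedChain_triple hb'.bot_covBy hb't)
      (by simpa [labelSeq] using hge)
    simp only [List.cons.injEq, true_and, and_true] at this
    exact hne this
  refine hnot ?_
  rw [heq]
  exact .cons (.rel ((hdesc.trans_eq heq).trans_le hle))

end Atomistic

end

-- The interlacing theorem

theorem theoremB {P Λ : Type*} [PartialOrder P] [BoundedOrder P] [Finite P]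
    [LocallyFiniteOrder P] [DecidableEq P] [GradeMinOrder ℕ P] [LinearOrder Λ]
    (lam : P → P → Λ) (hlam : IsUMELLabeling lam) :
    -- the `γ`-polynomials of the Chow and augmented Chow polynomials of upper intervals exist
    (∀ s : P, IsGammaPoly (intervalRank s ⊤ - 1) (chow s ⊤) (gammaChow s ⊤) ∧
      IsGammaPoly (intervalRank s ⊤) (augChow s ⊤) (gammaAugChow s ⊤)) ∧
    -- (i) Chow and augmented Chow polynomial of `P`
    (Interlaces (gammaChow (⊥ : P) ⊤) (gammaAugChow (⊥ : P) ⊤) ∧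
      ZerosInterlace (chow (⊥ : P) ⊤) (augChow (⊥ : P) ⊤)) ∧
    -- (ii) augmented Chow polynomial of `[a, ⊤]` and Chow polynomial of `P`
    (∀ a : P, IsAtom a →
      Interlaces (gammaAugChow a ⊤) (gammaChow (⊥ : P) ⊤) ∧
      ZerosInterlace (augChow a ⊤) ((1 + X) * chow (⊥ : P) ⊤)) ∧
    -- (iii) augmented Chow polynomials of `[a, ⊤]` and of `P`
    (∀ a : P, IsAtom a →
      Interlaces (gammaAugChow a ⊤) (gammaAugChow (⊥ : P) ⊤) ∧
      ZerosInterlace (augChow a ⊤) (augChow (⊥ : P) ⊤)) ∧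
    -- (iv) Chow polynomials of `[a, ⊤]` and of `P`, and the atomic case
    (LastLabelAllDescents lam →
      ∀ a : P, IsAtom a → Interlaces (gammaChow a ⊤) (gammaChow (⊥ : P) ⊤)) ∧
    (IsAtomistic P → LastLabelAllDescents lam) := by
  set N := Nat.card P + 1 with hN
  set w := corankWidth lam with hw
  set D := corankDes lam with hD
  set n := intervalRank (⊥ : P) ⊤ with hn
  have hw0 : ∀ m, w m 0 = 0 := corankWidth_zero lam
  have hDm : ∀ m, Monotone (D m) := corankDes_mono lam
  have hγ := hlam.isGammaPoly_chow
  have eC : ∀ s : P, gammaChow s ⊤ = totalNoFirstDescentPoly N w D (intervalRank s ⊤) :=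
    fun s => (hγ s).1.gammaPoly_eq
  have eA : ∀ s : P, gammaAugChow s ⊤ = totalPoly N w D (intervalRank s ⊤) :=
    fun s => (hγ s).2.gammaPoly_eq
  have pC : ∀ s : P, 0 < (totalNoFirstDescentPoly N w D (intervalRank s ⊤)).coeff 0 := fun s => by
    rw [← (hγ s).1.coeff_zero, chow_coeff_zero le_top]; exact one_pos
  have pA : ∀ s : P, 0 < (totalPoly N w D (intervalRank s ⊤)).coeff 0 := fun s => by
    rw [← (hγ s).2.coeff_zero, augChow_coeff_zero le_top]; exact one_pos
  have sC := totalNoFirstDescentPoly_stable (N := N) (w := w) hDm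
  have sA := totalPoly_stable (N := N) hw0 hDm
  have nC := totalNoFirstDescentPoly_coeff_nonneg (N := N) (w := w) (D := D)
  have nA := totalPoly_coeff_nonneg (N := N) (w := w) (D := D)
  have hrank : ∀ a : P, IsAtom a → n = intervalRank a ⊤ + 1 := fun a ha =>
    intervalRank_eq_succ ha.bot_covBy le_top
  refine ⟨fun s => ?_, ⟨?_, ?_⟩, fun a ha => ⟨?_, ?_⟩, fun a ha => ⟨?_, ?_⟩, fun _ a ha => ?_,
    fun _ => hlam.lastLabelAllDescents⟩
  · rw [eC, eA]
    exact hγ s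
  · rw [eC, eA]
    exact (properPos_noFirstDescent_total hw0 hDm n).interlaces (sC n) (sA n) (nC n) (nA n)
      (pC ⊥) (pA ⊥)
  · left
    have h := hγ ⊥
    have hp := properPos_noFirstDescent_total (N := N) hw0 hDm n
    -- In rank 0 the truncated `n - 1` is not one less than `n`, so the comparison of shifted
    -- centers does not apply; both polynomials are then 1.
    rcases hm : n with _ | m
    · have h0 : (⊥ : P) = ⊤ := eq_top_of_intervalRank_eq_zero (hn.symm.trans hm)
      have h1 : augChow (⊤ : P) ⊤ = 1 := by simp [augChow, intervalRank, chow_self]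
      rw [h0, chow_self, h1]
      refine (ProperPos.refl 1).interlaces .one .one ?_ ?_ (by simp) (by simp) <;>
      · intro k
        rw [coeff_one]
        split_ifs <;> norm_num
    · refine hp.interlaces_of_isGammaPoly h.1 ?_ (sC n) (sA n) (nC n) (nA n) (pC ⊥) (pA ⊥)
      rw [Nat.sub_add_cancel (show 1 ≤ n by omega)]
      exact h.2
  · rw [eA, eC]
    have hp := properPos_total_noFirstDescent_succ (N := N) hw0 hDm (intervalRank a ⊤)
    rw [← hrank a ha] at hp
    exact hp.interlaces (sA _) (sC n) (nA _) (nC n) (pA a) (pC ⊥)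
  · left
    have hp := properPos_total_noFirstDescent_succ (N := N) hw0 hDm (intervalRank a ⊤)
    rw [← hrank a ha] at hp
    -- The Chow polynomial of `P` and the augmented one of `[a, ⊤]` have the same center; the factor
    -- `1 + X` provides the offset of one half without changing the γ-polynomial.
    have h := (hγ ⊥).1.one_add_X_mul
    rw [show intervalRank (⊥ : P) ⊤ - 1 + 1 = intervalRank a ⊤ + 1 by
      have := hrank a ha; omega] at h
    exact hp.interlaces_of_isGammaPoly (hγ a).2 h (sA _) (sC n) (nA _) (nC n) (pA a) (pC ⊥)
  · rw [eA, eA]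
    have hp := properPos_total_succ (N := N) hw0 hDm (intervalRank a ⊤)
    rw [← hrank a ha] at hp
    exact hp.interlaces (sA _) (sA n) (nA _) (nA n) (pA a) (pA ⊥)
  · left
    have hp := properPos_total_succ (N := N) hw0 hDm (intervalRank a ⊤)
    rw [← hrank a ha] at hp
    have h := (hγ ⊥).2
    rw [← hn] at h
    nth_rewrite 1 [hrank a ha] at h
    exact hp.interlaces_of_isGammaPoly (hγ a).2 h (sA _) (sA n) (nA _) (nA n) (pA a) (pA ⊥)
  · rw [eC, eC]
    have hp := properPos_noFirstDescent_succ (N := N) (w := w) hDm (intervalRank a ⊤)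
    rw [← hrank a ha] at hp
    exact hp.interlaces (sC _) (sC n) (nC _) (nC n) (pC a) (pC ⊥)
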